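/- **Theorem (Policy Improvement Error).** *Setting.* Let $(\mathcal S,\mathcal A,\mathcal P,r,\gamma)$ be a Markov decision process with measurable state space, finite action space, Markov transition kernel $\mathcal P(\cdot\mid s,a)$, measurable reward $r$ and discount $\gamma\in(0,1)$. State-action pairs are identified, measurably, with vectors $(s,a)\in\mathbb R^d$ with $\|(s,a)\|_2\le 1$. Every policy $\pi$ has a stationary state distribution $\nu_\pi$, and $\sigma_\pi(s,a)=\pi(a\mid s)\nu_\pi(s)$ denotes its stationary state-action distribution. (For the energy-based policies below, $\nu_\pi$ depends measurably on the network parameters.) *Networks.* For $b\in\{-1,1\}^m$ and $\alpha=([\alpha]_1,\dots,[\alpha]_m)\in\mathbb R^{md}$ let $u_\alpha(s,a)=m^{-1/2}\sum_{i=1}^m b_i\max\{[\alpha]_i^\top(s,a),0\}$, and let $\nabla_\alpha u_\alpha(s,a)$ have blocks $m^{-1/2}b_i\mathbf 1\{[\alpha]_i^\top(s,a)>0\}(s,a)$. The initialization consists of independent $b_i\sim\mathrm{Unif}\{-1,1\}$ and $[\alpha(0)]_i\sim N(0,I_d/d)$. It is drawn once and shared by all networks, $f_\theta=u_\theta$ and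 $Q_\omega=u_\omega$ (so $m_f=m_Q=m$), with $b$ kept fixed. Write $\mathcal B^0(R)=\{\alpha:\|\alpha-\alpha(0)\|_2\le R\}$ and $\Pi_{\mathcal B^0(R)}$ for the Euclidean projection onto it. *Algorithm (neural PPO).* Fix $\beta>0$, $K\ge1$, $R_f\ge R_Q>0$, $T\ge 64$ and $\eta=T^{-1/2}$. Put $\tau_0=1$, $f_{\theta_0}=0$, $\pi_{\theta_0}=\pi_0$ (uniform), and $\tau_{k+1}=\beta\sqrt K/(k+1)$, $\beta_k=\beta\sqrt K$. For $k=0,\dots,K-1$ let $\pi_{\theta_k}\propto\exp\{\tau_k^{-1}f_{\theta_k}\}$, $\nu_k=\nu_{\pi_{\theta_k}}$, $\sigma_k=\nu_k\pi_{\theta_k}$, $\tilde\sigma_k=\nu_k\pi_0$ and do the following. 1. (TD) Draw $T$ i.i.d. samples $(s,a,s',a')$ with $(s,a)\sim\sigma_k$, $s'\sim\mathcal P(\cdot\mid s,a)$, $a'\sim\pi_{\theta_k}(\cdot\mid s')$. Start from $\omega(0)=\alpha(0)$ and set $\omega(t+1)=\Pi_{\mathcal B^0(R_Q)}\bigl(\omega(t)-\eta\,(Q_{\omega(t)}(s,a)-(1-\gamma)r(s,a)-\gamma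 Q_{\omega(t)}(s',a'))\nabla_\omega Q_{\omega(t)}(s,a)\bigr)$, with the $(t+1)$-st sample. Put $\omega_k=T^{-1}\sum_{t<T}\omega(t)$. 2. (SGD) Draw $T$ i.i.d. samples $(s,a)\sim\tilde\sigma_k$, independently of the TD samples given the initialization and $\theta_k$. Start from $\theta(0)=\alpha(0)$ and set $\theta(t+1)=\Pi_{\mathcal B^0(R_f)}\bigl(\theta(t)-\eta\,(f_{\theta(t)}(s,a)-\tau_{k+1}(\beta_k^{-1}Q_{\omega_k}(s,a)+\tau_k^{-1}f_{\theta_k}(s,a)))\nabla_\theta f_{\theta(t)}(s,a)\bigr)$, with the $(t+1)$-st sample. Put $\overline\theta=T^{-1}\sum_{t<T}\theta(t)$ and $\theta_{k+1}=\overline\theta$. *Assumptions.* The reward is bounded. There is a constant $c>0$ such that for every policy $\pi$, every $z\in\mathbb R^d\setminus\{0\}$ and every $\zeta>0$ one has $\mathbb P_{(s,a)\sim\sigma_\pi}(|z^\top(s,a)|\le\zeta)\le c\,\zeta/\|z\|_2$. *Conclusion.* For every $r_0>0$ there is a constant $C>0$, depending only on $d$, $c$ and $r_0$ (and not on the decision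 process, $\beta$, $K$, $k$, $m$, $T$, $R_f$ or $R_Q$), such that if $R_f\ge r_0$, $m\ge1$ and $T\ge64$, then for each $k<K$ the output of the SGD in the $k$-th iteration satisfies $$\mathbb E\Bigl[\mathbb E_{(s,a)\sim\tilde\sigma_k}\bigl[\bigl(f_{\overline\theta}(s,a)-\tau_{k+1}(\beta_k^{-1}Q_{\omega_k}(s,a)+\tau_k^{-1}f_{\theta_k}(s,a))\bigr)^2\bigr]\Bigr]\le C\bigl(R_f^2T^{-1/2}+R_f^{5/2}m^{-1/4}+R_f^3m^{-1/2}\bigr),$$ where the outer expectation is over the random initialization and all samples drawn up to the end of iteration $k$. -/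

import Mathlib

open MeasureTheory ProbabilityTheory
open scoped ENNReal

noncomputable section

namespace NeuralPPO

/-! ### Markov decision processes, policies, stationary distributions -/

/-- A discounted Markov decision process with states `S` and actions `A`, whose state-action pairs
are identified with vectors of the unit ball of `ℝᵈ` through `vec`. -/
structure MDP (S A : Type*) [MeasurableSpace S] [MeasurableSpace A] (d : ℕ) where
  /-- transition kernel: `trans (s, a)` is the law of the next state -/
  trans : Kernel (S × A) S
  isMarkov : IsMarkovKernel trans
  /-- reward function -/
  reward : S × A → ℝ
  measurable_reward : Measurable reward
  /-- discount factor -/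
  γ : ℝ
  γ_pos : 0 < γ
  γ_lt_one : γ < 1
  /-- the vector in `ℝᵈ` that a state-action pair stands for -/
  vec : S × A → EuclideanSpace ℝ (Fin d)
  measurable_vec : Measurable vec
  norm_vec_le_one : ∀ x, ‖vec x‖ ≤ 1

/-- The reward is bounded. -/
def BoundedReward {S A : Type*} [MeasurableSpace S] [MeasurableSpace A] {d : ℕ}
    (M : MDP S A d) : Prop :=
  ∃ Rmax : ℝ, 0 < Rmax ∧ ∀ x, |M.reward x| ≤ Rmax

/-- `ν` is a stationary state distribution of the policy `π` (a Markov kernel from states to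
actions): it is invariant under `s ↦ s'`, where `a ∼ π(· | s)` and `s' ∼ trans (s, a)`. -/
def IsStationary {S A : Type*} [MeasurableSpace S] [MeasurableSpace A] {d : ℕ}
    (M : MDP S A d) (π : Kernel S A) (ν : Measure S) : Prop :=
  IsProbabilityMeasure ν ∧ Kernel.Invariant (M.trans ∘ₖ (Kernel.id ×ₖ π)) ν

/-- Regularity of the stationary state-action distributions `σ_π = ν_π π`, with constant `c`:
`P_{σ_π}(|zᵀ(s,a)| ≤ ζ) ≤ c ζ / ‖z‖` for every policy `π`, every `z ≠ 0` and every `ζ > 0`.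
Here `stat π` is the stationary state distribution `ν_π`. -/
def RegularStationary {S A : Type*} [MeasurableSpace S] [MeasurableSpace A] {d : ℕ}
    (M : MDP S A d) (stat : Kernel S A → Measure S) (c : ℝ) : Prop :=
  ∀ π : Kernel S A, IsMarkovKernel π → ∀ z : EuclideanSpace ℝ (Fin d), z ≠ 0 → ∀ ζ : ℝ, 0 < ζ →
    (stat π ⊗ₘ π) {x | |inner ℝ z (M.vec x)| ≤ ζ} ≤ ENNReal.ofReal (c * ζ / ‖z‖)

/-- The energy-based policy `π(a | s) ∝ exp (τ⁻¹ f(s, a))`. -/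
def energyPolicy {S A : Type*} [MeasurableSpace S] [MeasurableSpace A] [Fintype A]
    (τ : ℝ) (f : S × A → ℝ) (hf : Measurable f) : Kernel S A where
  toFun s := ∑ a : A, ENNReal.ofReal
    (Real.exp (τ⁻¹ * f (s, a)) / ∑ a' : A, Real.exp (τ⁻¹ * f (s, a'))) • Measure.dirac a
  measurable' := by
    have h : ∀ a : A, Measurable fun s : S => f (s, a) := fun a =>
      hf.comp measurable_prodMk_right
    refine Measure.measurable_of_measurable_coe _ fun B _ => ?_
    simp only [Measure.coe_finsetSum, Finset.sum_apply, Measure.smul_apply, smul_eq_mul]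
    refine Finset.measurable_sum _ fun a _ => Measurable.mul_const ?_ _
    refine ENNReal.measurable_ofReal.comp (Measurable.div ?_ ?_)
    · exact Real.measurable_exp.comp ((h a).const_mul _)
    · exact Finset.measurable_sum _ fun a' _ => Real.measurable_exp.comp ((h a').const_mul _)

instance {S A : Type*} [MeasurableSpace S] [MeasurableSpace A] [Fintype A] [Nonempty A]
    (τ : ℝ) (f : S × A → ℝ) (hf : Measurable f) : IsMarkovKernel (energyPolicy τ f hf) where
  isProbabilityMeasure s := by
    constructor
    have hpos : 0 < ∑ a' : A, Real.exp (τ⁻¹ * f (s, a')) :=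
      Finset.sum_pos (fun _ _ => Real.exp_pos _) Finset.univ_nonempty
    change (∑ a : A, ENNReal.ofReal (Real.exp (τ⁻¹ * f (s, a)) /
      ∑ a' : A, Real.exp (τ⁻¹ * f (s, a'))) • Measure.dirac a : Measure A) Set.univ = 1
    simp only [Measure.coe_finsetSum, Finset.sum_apply, Measure.smul_apply, smul_eq_mul,
      measure_univ, mul_one]
    rw [← ENNReal.ofReal_sum_of_nonneg fun a _ => div_nonneg (Real.exp_pos _).le hpos.le,
      ← Finset.sum_div, div_self hpos.ne', ENNReal.ofReal_one]

/-! ### Two-layer ReLU networks -/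

/-- Input weights `α = (α_1, …, α_m)`, `α_i ∈ ℝᵈ`, with the Euclidean norm of `ℝ^{md}`. -/
abbrev Weights (m d : ℕ) : Type := PiLp 2 fun _ : Fin m => EuclideanSpace ℝ (Fin d)

/-- The network `m^{-1/2} ∑ᵢ bᵢ max (αᵢᵀ x, 0)`. -/
def nn {m d : ℕ} (b : Fin m → ℝ) (α : Weights m d) (x : EuclideanSpace ℝ (Fin d)) : ℝ :=
  (√(m : ℝ))⁻¹ * ∑ i, b i * max (inner ℝ (α i) x) 0

open Classical in
/-- The gradient of the network in the input weights, with blocks `m^{-1/2} bᵢ 1{αᵢᵀ x > 0} x`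
(at a kink the derivative of the ReLU is taken to be `0`). -/
def nnGrad {m d : ℕ} (b : Fin m → ℝ) (α : Weights m d) (x : EuclideanSpace ℝ (Fin d)) :
    Weights m d :=
  WithLp.toLp 2 fun i =>
    ((√(m : ℝ))⁻¹ * b i * (if 0 < (inner ℝ (α i) x : ℝ) then 1 else 0)) • x

theorem measurable_nn {m d : ℕ} (b : Fin m → ℝ) (α : Weights m d) : Measurable (nn b α) := by
  unfold nn
  exact Continuous.measurable (by fun_prop)

/-- Projection onto the closed ball with centre `c` and radius `R`. -/
def projBall {E : Type*} [NormedAddCommGroup E] [NormedSpace ℝ E] (c : E) (R : ℝ) (y : E) : E :=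
  if ‖y - c‖ ≤ R then y else c + (R / ‖y - c‖) • (y - c)

/-- `projBall c R y` is a point of the ball that is nearest to `y`. -/
theorem projBall_isNearest {E : Type*} [NormedAddCommGroup E] [NormedSpace ℝ E] (c : E) {R : ℝ}
    (hR : 0 ≤ R) (y : E) :
    ‖projBall c R y - c‖ ≤ R ∧ ∀ z : E, ‖z - c‖ ≤ R → ‖projBall c R y - y‖ ≤ ‖z - y‖ := by
  unfold projBall
  split_ifs with h
  · exact ⟨h, fun z _ => by simp⟩
  · push Not at h
    have hpos : 0 < ‖y - c‖ := hR.trans_lt h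
    have h1 : ‖c + (R / ‖y - c‖) • (y - c) - c‖ = R := by
      rw [add_sub_cancel_left, norm_smul, Real.norm_of_nonneg (by positivity)]
      field_simp
    have h2 : ‖c + (R / ‖y - c‖) • (y - c) - y‖ = ‖y - c‖ - R := by
      have : c + (R / ‖y - c‖) • (y - c) - y = (R / ‖y - c‖ - 1) • (y - c) := by
        rw [sub_smul, one_smul]; abel
      rw [this, norm_smul, Real.norm_of_nonpos (by rw [sub_nonpos, div_le_one hpos]; exact h.le)]
      field_simp
      ring
    refine ⟨h1.le, fun z hz => ?_⟩
    rw [h2]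
    have h3 : ‖y - c‖ ≤ ‖z - y‖ + ‖z - c‖ := by
      have : y - c = (z - c) - (z - y) := by abel
      rw [this]
      linarith [norm_sub_le (z - c) (z - y)]
    linarith

/-- The uniform distribution on `{-1, 1}`. -/
def signLaw : Measure ℝ := (2⁻¹ : ℝ≥0∞) • Measure.dirac 1 + (2⁻¹ : ℝ≥0∞) • Measure.dirac (-1)

/-- The normal distribution `N(0, I_d / d)`. -/
def initGaussian (d : ℕ) : Measure (EuclideanSpace ℝ (Fin d)) :=
  (stdGaussian (EuclideanSpace ℝ (Fin d))).map fun z => (√(d : ℝ))⁻¹ • z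

/-- An initialization `(b, α(0))`. -/
abbrev Init (m d : ℕ) : Type := (Fin m → ℝ) × Weights m d

/-- The law of the random initialization: `bᵢ ∼ Unif{-1, 1}` and `α(0)ᵢ ∼ N(0, I_d / d)`, all
independent. -/
def initLaw (m d : ℕ) : Measure (Init m d) :=
  (Measure.pi fun _ : Fin m => signLaw).prod
    ((Measure.pi fun _ : Fin m => initGaussian d).map (WithLp.toLp 2))

/-- The iterates `α(0) = c`, `α(t+1) = Π (α(t) - η g(α(t), D_t))`, where `Π` is the projection onto
the ball of radius `R` around the initial point `c`. -/
def projIter {E X : Type*} [NormedAddCommGroup E] [NormedSpace ℝ E] {T : ℕ} (g : E → X → E)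
    (c : E) (R η : ℝ) (D : Fin T → X) : ℕ → E
  | 0 => c
  | t + 1 =>
    if h : t < T then
      projBall c R (projIter g c R η D t - η • g (projIter g c R η D t) (D ⟨t, h⟩))
    else projIter g c R η D t

/-- The average over the path, `T⁻¹ ∑_{t < T} α(t)`. -/
def pathAverage {E X : Type*} [NormedAddCommGroup E] [NormedSpace ℝ E] {T : ℕ} (g : E → X → E)
    (c : E) (R η : ℝ) (D : Fin T → X) : E :=
  (T : ℝ)⁻¹ • ∑ t ∈ Finset.range T, projIter g c R η D t

/-! ### Neural PPO -/

/-- Parameters of neural PPO: penalty parameter, projection radii, number of iterations. -/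
structure Params where
  β : ℝ
  β_pos : 0 < β
  Rf : ℝ
  RQ : ℝ
  RQ_pos : 0 < RQ
  RQ_le_Rf : RQ ≤ Rf
  K : ℕ

/-- `τ_0 = 1` and `τ_{k+1} = β √K / (k + 1)`. -/
def Params.τ (p : Params) : ℕ → ℝ
  | 0 => 1
  | k + 1 => p.β * √(p.K : ℝ) / ((k : ℝ) + 1)

/-- `β_k = β √K`. -/
def Params.βk (p : Params) : ℝ := p.β * √(p.K : ℝ)

section

variable {S A : Type*} [MeasurableSpace S] [MeasurableSpace A] {m d : ℕ}

/-- The energy function `f_{θ_k}`; it is the zero function for `k = 0`. -/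
def energy (M : MDP S A d) (k : ℕ) (b : Fin m → ℝ) (θ : Weights m d) (x : S × A) : ℝ :=
  if k = 0 then 0 else nn b θ (M.vec x)

theorem measurable_energy (M : MDP S A d) (k : ℕ) (b : Fin m → ℝ) (θ : Weights m d) :
    Measurable (energy M k b θ) := by
  unfold energy
  split_ifs
  · exact measurable_const
  · exact (measurable_nn b θ).comp M.measurable_vec

/-- The target `τ_{k+1} (β_k⁻¹ Q_ω + τ_k⁻¹ f_{θ_k})` of policy improvement. -/
def target (M : MDP S A d) (p : Params) (k : ℕ) (b : Fin m → ℝ) (θ ω : Weights m d)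
    (x : S × A) : ℝ :=
  p.τ (k + 1) * (p.βk⁻¹ * nn b ω (M.vec x) + (p.τ k)⁻¹ * energy M k b θ x)

/-- Policy improvement by projected SGD with stepsize `T^{-1/2}`: the averaged weights `θ̄`
obtained from the initialization `i = (b, α(0))`, the current weights `θ = θ_k`, the weights
`ω = ω_k` and the sample `D_t = (s_{t+1}, a⁰_{t+1})`, `t < T`. -/
def sgdOutput {T : ℕ} (M : MDP S A d) (p : Params) (k : ℕ) (i : Init m d) (θ ω : Weights m d)
    (D : Fin T → S × A) : Weights m d :=
  pathAverage
    (fun ϑ x => (nn i.1 ϑ (M.vec x) - target M p k i.1 θ ω x) • nnGrad i.1 ϑ (M.vec x))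
    i.2 p.Rf (√(T : ℝ))⁻¹ D

/-- Policy evaluation by projected TD with stepsize `T^{-1/2}`: the averaged weights `ω̄` obtained
from the initialization `i = (b, α(0))` and the sample `D_t = (((s, a), s'), a')`, `t < T`. -/
def tdOutput {T : ℕ} (M : MDP S A d) (p : Params) (i : Init m d)
    (D : Fin T → ((S × A) × S) × A) : Weights m d :=
  pathAverage
    (fun w x => (nn i.1 w (M.vec x.1.1) - (1 - M.γ) * M.reward x.1.1
        - M.γ * nn i.1 w (M.vec (x.1.2, x.2))) • nnGrad i.1 w (M.vec x.1.1))
    i.2 p.RQ (√(T : ℝ))⁻¹ D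

variable [Fintype A]

/-- The policy `π_{θ_k} ∝ exp (τ_k⁻¹ f_{θ_k})`. -/
def policy (M : MDP S A d) (p : Params) (k : ℕ) (b : Fin m → ℝ) (θ : Weights m d) :
    Kernel S A :=
  energyPolicy (p.τ k) (energy M k b θ) (measurable_energy M k b θ)

/-- `ν_k`, the stationary state distribution of `π_{θ_k}`. -/
def nuK (M : MDP S A d) (stat : Kernel S A → Measure S) (p : Params) (k : ℕ)
    (b : Fin m → ℝ) (θ : Weights m d) : Measure S :=
  stat (policy M p k b θ)

/-- `σ̃_k = ν_k π_0`. -/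
def sigmaTilde (M : MDP S A d) (stat : Kernel S A → Measure S) (p : Params) (k : ℕ)
    (b : Fin m → ℝ) (θ : Weights m d) : Measure (S × A) :=
  nuK M stat p k b θ ⊗ₘ policy M p 0 b θ

/-- The law of a TD sample `(((s, a), s'), a')`: `(s, a) ∼ σ_k = ν_k π_{θ_k}`,
`s' ∼ trans (s, a)` and `a' ∼ π_{θ_k}(· | s')`. -/
def tdLaw (M : MDP S A d) (stat : Kernel S A → Measure S) (p : Params) (k : ℕ)
    (b : Fin m → ℝ) (θ : Weights m d) : Measure (((S × A) × S) × A) :=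
  ((nuK M stat p k b θ ⊗ₘ policy M p k b θ) ⊗ₘ M.trans) ⊗ₘ
    Kernel.prodMkLeft (S × A) (policy M p k b θ)

/-- What is random up to the end of an iteration: the initialization, the weights `θ_k` at the
beginning of the iteration, and the TD and SGD samples that are drawn in it. -/
abbrev Run (S A : Type*) (m d T : ℕ) : Type _ :=
  (Init m d × Weights m d) × ((Fin T → ((S × A) × S) × A) × (Fin T → S × A))

/-- Given the law of `((b, α(0)), θ_k)`, the joint law with the samples of the `k`-th iteration:
given `((b, α(0)), θ_k)`, the `T` TD samples and the `T` SGD samples, drawn from `σ̃_k`, are all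
independent. -/
def extendLaw (M : MDP S A d) (stat : Kernel S A → Measure S) (p : Params) (T k : ℕ)
    (μ : Measure (Init m d × Weights m d)) : Measure (Run S A m d T) :=
  μ.bind fun s =>
    ((Measure.pi fun _ : Fin T => tdLaw M stat p k s.1.1 s.2).prod
      (Measure.pi fun _ : Fin T => sigmaTilde M stat p k s.1.1 s.2)).map fun D => (s, D)

/-- The weights `ω_k` of the action-value estimator `Q_{ω_k}` computed in the `k`-th iteration. -/
def Run.omega {T : ℕ} (M : MDP S A d) (p : Params) (ξ : Run S A m d T) : Weights m d :=
  tdOutput M p ξ.1.1 ξ.2.1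

/-- The weights `θ̄ = θ_{k+1}` computed in the `k`-th iteration. -/
def Run.thetaBar {T : ℕ} (M : MDP S A d) (p : Params) (k : ℕ) (ξ : Run S A m d T) :
    Weights m d :=
  sgdOutput M p k ξ.1.1 ξ.1.2 (Run.omega M p ξ) ξ.2.2

/-- The law of `((b, α(0)), θ_k)` in neural PPO (the value of `θ_0` plays no role, as `f_{θ_0}` is
set to `0`). -/
def ppoLaw (M : MDP S A d) (stat : Kernel S A → Measure S) (p : Params) (m T : ℕ) :
    ℕ → Measure (Init m d × Weights m d)
  | 0 => (initLaw m d).map fun i => (i, i.2)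
  | k + 1 => (extendLaw M stat p T k (ppoLaw M stat p m T k)).map fun ξ =>
      (ξ.1.1, Run.thetaBar M p k ξ)

/-- The law of the `k`-th iteration of neural PPO. -/
def runLaw (M : MDP S A d) (stat : Kernel S A → Measure S) (p : Params) (m T k : ℕ) :
    Measure (Run S A m d T) :=
  extendLaw M stat p T k (ppoLaw M stat p m T k)

end

end NeuralPPO

end

/-! ### Projected stochastic gradient descent for networks that are linear along their gradient -/

namespace NeuralPPO

/-! The ReLU network is positively homogeneous in its weights, so `nn b α x` equals `⟪nnGrad b α x,
α⟫` exactly (`nn_eq_inner_nnGrad`). If, for all `α`, `α'` in the ball around `α(0)` and all `x` in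
the unit ball, `nn b α' x` differs from `⟪nnGrad b α x, α'⟫` by at most `√B`, then SGD behaves like
least squares with a linear model. The schedules of `τ` and `β` make the target a convex combination
of `Q_ω` and `f_θ` (`target_eq`), so the same combination `z` of `ω` and `θ` stays in the ball and
fits the target up to `B` (`exists_target_approx`).

The regret bound `sum_sq_projIter_le` is pathwise. The second-order term of a step is at most `η`
times the current squared loss and is absorbed because `η ≤ 1/8`, so neither a bound on the targets
nor a variance estimate enters. Since the `t`-th iterate does not depend on the `t`-th sample, the
expected empirical loss equals the expected population loss. Passing to the averaged weights costs a
further multiple of `B`, which gives `4 R² T^{-1/2} + 10 B` (`lintegral_pathAverage_sq_le`).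

It remains to bound `E B`. Only neurons whose activation changes contribute: those that moved by
more than `t`, at most `R²/t²` of them, and those nearly orthogonal to `x` at initialization
(`sq_nn_sub_inner_nnGrad_le`). The sampling law depends on the initialization through `θ_k`, so the
second kind is counted uniformly over directions. An exponential moment, combined with averaging
over small balls in place of a net, shows that the maximal count is of order `m (√r + r)` in
expectation, with `r = R/√m` and `t = √r` (`exists_uniform_count_le`). As `B` is of order `R²
(count/m + r)`, the rates `R^{5/2} m^{-1/4}` and `R³ m^{-1/2}` follow. Earlier iterations matter
only in that they keep the law of the initialization and leave `θ_k` in the ball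
(`lintegral_ppoLaw_le`). -/

theorem norm_projBall_sub_le {E : Type*} [NormedAddCommGroup E] [InnerProductSpace ℝ E]
    {c : E} {R : ℝ} {z : E} (hz : ‖z - c‖ ≤ R) (y : E) :
    ‖projBall c R y - z‖ ≤ ‖y - z‖ := by
  unfold projBall
  split_ifs with h
  · exact le_rfl
  · push Not at h
    have hR : 0 ≤ R := (norm_nonneg _).trans hz
    have hn : 0 < ‖y - c‖ := hR.trans_lt h
    set v := y - c with hv
    set w := z - c with hw
    set s := R / ‖v‖ with hs
    have hs0 : 0 ≤ s := by positivity
    have hs1 : s ≤ 1 := (div_le_one hn).2 h.le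
    have hsn : s * ‖v‖ = R := by rw [hs]; field_simp
    have e1 : c + s • v - z = s • v - w := by rw [hw]; abel
    have e2 : y - z = v - w := by rw [hv, hw]; abel
    rw [e1, e2]
    refine le_of_sq_le_sq ?_ (norm_nonneg _)
    rw [norm_sub_sq_real (s • v), norm_sub_sq_real v, norm_smul, Real.norm_of_nonneg hs0,
      real_inner_smul_left]
    have hin : inner ℝ v w ≤ s * ‖v‖ ^ 2 := by
      calc inner ℝ v w ≤ ‖v‖ * ‖w‖ := real_inner_le_norm _ _
        _ ≤ ‖v‖ * R := by gcongr
        _ = s * ‖v‖ ^ 2 := by rw [← hsn]; ring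
    -- By `hin`, the right side exceeds the left by at least `(1 - s)² ‖v‖²`.
    nlinarith [mul_le_mul_of_nonneg_left hin (sub_nonneg.2 hs1),
      mul_nonneg (sq_nonneg (1 - s)) (sq_nonneg ‖v‖)]

/-! ### Confinement, causality and measurability of the projected iterates. -/

section iterates

variable {E X : Type*} [NormedAddCommGroup E] [NormedSpace ℝ E] {T : ℕ}

theorem norm_projIter_sub_le (g : E → X → E) (c : E) {R : ℝ} (hR : 0 ≤ R) (η : ℝ)
    (D : Fin T → X) (t : ℕ) : ‖projIter g c R η D t - c‖ ≤ R := by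
  induction t with
  | zero => simpa [projIter] using hR
  | succ t ih =>
    rw [projIter]
    split_ifs
    · exact (projBall_isNearest c hR _).1
    · exact ih

theorem norm_pathAverage_sub_le (g : E → X → E) (c : E) {R : ℝ} (hR : 0 ≤ R) (η : ℝ)
    (hT : 0 < T) (D : Fin T → X) : ‖pathAverage g c R η D - c‖ ≤ R := by
  have hT' : (0 : ℝ) < T := by exact_mod_cast hT
  have h : pathAverage g c R η D - c
      = (T : ℝ)⁻¹ • ∑ t ∈ Finset.range T, (projIter g c R η D t - c) := by
    rw [pathAverage, Finset.sum_sub_distrib, smul_sub, Finset.sum_const, Finset.card_range,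
      ← Nat.cast_smul_eq_nsmul ℝ, smul_smul, inv_mul_cancel₀ hT'.ne', one_smul]
  rw [h, norm_smul, norm_inv, Real.norm_of_nonneg hT'.le, inv_mul_le_iff₀ hT']
  refine (norm_sum_le _ _).trans ((Finset.sum_le_card_nsmul _ _ R fun t _ =>
    norm_projIter_sub_le g c hR η D t).trans ?_)
  simp

/-- The iterate at time `t` reads only the samples with index below `t`. The case `t = j` is
included, which makes the `t`-th sample fresh for the `t`-th iterate. -/
theorem projIter_update_of_le [DecidableEq (Fin T)] (g : E → X → E) (c : E) (R η : ℝ)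
    (D : Fin T → X) (j : Fin T) (x : X) (t : ℕ) (ht : t ≤ j) :
    projIter g c R η (Function.update D j x) t = projIter g c R η D t := by
  induction t with
  | zero => rfl
  | succ t ih =>
    have hne : ∀ h : t < T, (⟨t, h⟩ : Fin T) ≠ j := fun h he => by
      have := congrArg Fin.val he
      simp only at this
      omega
    simp only [projIter, ih (by omega)]
    split_ifs with h
    · rw [Function.update_of_ne (hne h)]
    · rfl

theorem measurable_projBall [MeasurableSpace E] [BorelSpace E] [SecondCountableTopology E]
    (c : E) (R : ℝ) : Measurable (projBall c R) := by
  unfold projBall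
  refine Measurable.ite (measurableSet_le (by fun_prop) measurable_const) measurable_id ?_
  fun_prop

theorem measurable_projIter [MeasurableSpace E] [BorelSpace E] [SecondCountableTopology E]
    [MeasurableSpace X] {g : E → X → E} (hg : Measurable fun q : E × X => g q.1 q.2)
    (c : E) (R η : ℝ) (t : ℕ) : Measurable fun D : Fin T → X => projIter g c R η D t := by
  induction t with
  | zero => exact measurable_const
  | succ t ih =>
    simp only [projIter]
    split_ifs with h
    · refine (measurable_projBall c R).comp (ih.sub (Measurable.const_smul ?_ η))
      exact hg.comp (ih.prodMk (measurable_pi_apply _))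
    · exact ih

end iterates

/-- A fresh sample may be integrated out separately. -/
theorem lintegral_pi_apply_eq {ι X : Type*} [Fintype ι] [DecidableEq ι] [MeasurableSpace X]
    (μ : Measure X) [IsProbabilityMeasure μ] (i : ι) {F : (ι → X) → X → ℝ≥0∞}
    (hF : Measurable fun q : (ι → X) × X => F q.1 q.2)
    (hi : ∀ D x y, F (Function.update D i x) y = F D y) :
    ∫⁻ D, F D (D i) ∂(Measure.pi fun _ => μ)
      = ∫⁻ D, ∫⁻ x, F D x ∂μ ∂(Measure.pi fun _ => μ) := by
  -- Integrating out the coordinate `i` alone already makes the two integrands agree, because the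
  -- first argument of `F` ignores that coordinate.
  refine lintegral_eq_of_lmarginal_eq {i} ?_ ?_ ?_
  · exact hF.comp (measurable_id.prodMk (measurable_pi_apply i))
  · exact hF.lintegral_prod_right'
  · ext D
    simp [lmarginal_singleton, hi]

theorem lintegral_sum_pi_apply_eq {ι X : Type*} [Fintype ι] [DecidableEq ι] [MeasurableSpace X]
    (μ : Measure X) [IsProbabilityMeasure μ] {F : ι → (ι → X) → X → ℝ≥0∞}
    (hF : ∀ i, Measurable fun q : (ι → X) × X => F i q.1 q.2)
    (hi : ∀ i D x y, F i (Function.update D i x) y = F i D y) :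
    ∫⁻ D, ∑ i, ∫⁻ x, F i D x ∂μ ∂(Measure.pi fun _ => μ)
      = ∫⁻ D, ∑ i, F i D (D i) ∂(Measure.pi fun _ => μ) := by
  rw [lintegral_finsetSum Finset.univ fun i _ => (hF i).lintegral_prod_right']
  have hd : ∀ i, Measurable fun D => F i D (D i) := fun i =>
    (hF i).comp (measurable_id.prodMk (measurable_pi_apply i))
  rw [lintegral_finsetSum Finset.univ fun i _ => hd i]
  exact Finset.sum_congr rfl fun i _ => (lintegral_pi_apply_eq μ i (hF i) (hi i)).symm

section sgd

variable {E X : Type*} [NormedAddCommGroup E] [InnerProductSpace ℝ E] {T : ℕ}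

/-- The regret bound of projected SGD with stepsize `T^{-1/2}` for the squared loss. -/
theorem sum_sq_projIter_le {h : E → X → ℝ} {G : E → X → E} {y : X → ℝ} {c z : E} {R B : ℝ}
    (hT : 64 ≤ T) (hG : ∀ α x, ‖G α x‖ ≤ 1) (hlin : ∀ α x, h α x = inner ℝ (G α x) α)
    (hz : ‖z - c‖ ≤ R)
    (hB : ∀ α x, ‖α - c‖ ≤ R → (y x - inner ℝ (G α x) z) ^ 2 ≤ B) (D : Fin T → X) :
    ∑ t : Fin T, (h (projIter (fun α x => (h α x - y x) • G α x) c R (√(T : ℝ))⁻¹ D t) (D t)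
        - y (D t)) ^ 2 ≤ 8 / 7 * (R ^ 2 * √(T : ℝ) + T * B) := by
  have hR : 0 ≤ R := (norm_nonneg _).trans hz
  set η : ℝ := (√(T : ℝ))⁻¹ with hη
  have hs : (8 : ℝ) ≤ √(T : ℝ) := by
    refine Real.le_sqrt_of_sq_le ?_
    have : (64 : ℝ) ≤ T := by exact_mod_cast hT
    linarith
  have hη0 : 0 < η := by positivity
  have hη8 : η ≤ 1 / 8 := by
    rw [hη, inv_eq_one_div]
    exact one_div_le_one_div_of_le (by norm_num) hs
  set g : E → X → E := fun α x => (h α x - y x) • G α x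
  set α : ℕ → E := projIter g c R η D
  have step : ∀ t : Fin T, η * (7 / 8 * (h (α t) (D t) - y (D t)) ^ 2 - B)
      ≤ ‖α t - z‖ ^ 2 - ‖α (t + 1) - z‖ ^ 2 := by
    intro t
    have h1 : ‖α (t + 1) - z‖ ≤ ‖α t - η • g (α t) (D t) - z‖ := by
      have : α (t + 1) = projBall c R (α t - η • g (α t) (D t)) := by
        change projIter g c R η D (t + 1) = _
        rw [projIter, dif_pos t.2]
      rw [this]
      exact norm_projBall_sub_le hz _
    have h2 : ‖α (t + 1) - z‖ ^ 2 ≤ ‖α t - η • g (α t) (D t) - z‖ ^ 2 := by gcongr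
    have h3 : α t - η • g (α t) (D t) - z = (α t - z) - η • g (α t) (D t) := by abel
    rw [h3, norm_sub_sq_real (α t - z), real_inner_smul_right, norm_smul, Real.norm_of_nonneg hη0.le] at h2
    set δ := h (α t) (D t) - y (D t) with hδ
    have h4 : inner ℝ (α t - z) (g (α t) (D t))
        -- `hlin` turns `⟪G, α - z⟫` into the residual plus the approximation error of `z`, with no
        -- convexity of `h` needed.
        = δ * (δ + (y (D t) - inner ℝ (G (α t) (D t)) z)) := by
      change inner ℝ (α t - z) (δ • G (α t) (D t)) = _
      rw [real_inner_smul_right, inner_sub_left, real_inner_comm, ← hlin,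
        real_inner_comm z, hδ]
      ring
    have h5 : ‖g (α t) (D t)‖ ^ 2 ≤ δ ^ 2 := by
      change ‖δ • G (α t) (D t)‖ ^ 2 ≤ _
      rw [norm_smul, mul_pow, Real.norm_eq_abs, sq_abs]
      have := pow_le_one₀ (n := 2) (norm_nonneg _) (hG (α t) (D t))
      nlinarith [sq_nonneg δ]
    have h6 := hB (α t) (D t) (norm_projIter_sub_le g c hR η D t)
    set e := y (D t) - inner ℝ (G (α t) (D t)) z
    rw [h4] at h2
    -- The gradient is the residual times a vector of norm at most 1, so for `η ≤ 1/8` the quadratic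
    -- term is a small fraction of the loss itself.
    have h7 : (η * ‖g (α t) (D t)‖) ^ 2 ≤ η * (1 / 8 * δ ^ 2) := by
      calc (η * ‖g (α t) (D t)‖) ^ 2 = η * (η * ‖g (α t) (D t)‖ ^ 2) := by ring
        _ ≤ η * (1 / 8 * δ ^ 2) := by gcongr
    -- The slack inside the bracket is `(δ + e)² + (B - e²)`.
    have h8 : η * (7 / 8 * δ ^ 2 - B) ≤ η * (2 * (δ * (δ + e)) - 1 / 8 * δ ^ 2) := by
      refine mul_le_mul_of_nonneg_left ?_ hη0.le
      nlinarith [sq_nonneg (δ + e)]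
    nlinarith
  have hsum := Finset.sum_le_sum fun t (_ : t ∈ Finset.univ) => step t
  rw [← Finset.mul_sum, Finset.sum_sub_distrib, ← Finset.mul_sum, Finset.sum_const,
    Finset.card_univ, Fintype.card_fin, nsmul_eq_mul,
    Fin.sum_univ_eq_sum_range (fun t => ‖α t - z‖ ^ 2 - ‖α (t + 1) - z‖ ^ 2),
    Finset.sum_range_sub'] at hsum
  have h0 : ‖α 0 - z‖ ^ 2 ≤ R ^ 2 := by
    have : α 0 = c := rfl
    rw [this, norm_sub_rev]
    gcongr
  have hfin : η * (7 / 8 * ∑ t : Fin T, (h (α t) (D t) - y (D t)) ^ 2 - T * B) ≤ R ^ 2 := by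
    linarith [sq_nonneg ‖α T - z‖]
  rw [hη, inv_mul_le_iff₀ (by positivity)] at hfin
  linarith

/-- The squared error of the averaged iterate is at most the averaged squared error, up to the
linearization error `B`. -/
theorem sq_pathAverage_sub_le {h : E → X → ℝ} {G : E → X → E} (g : E → X → E) (c : E) {R B : ℝ}
    (hR : 0 ≤ R) (η : ℝ) (hT : 0 < T)
    (hB : ∀ α x, ‖α - c‖ ≤ R → (h α x - inner ℝ (G c x) α) ^ 2 ≤ B) (D : Fin T → X) (x : X)
    (v : ℝ) :
    (h (pathAverage g c R η D) x - v) ^ 2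
      ≤ 3 * (T : ℝ)⁻¹ * ∑ t : Fin T, (h (projIter g c R η D t) x - v) ^ 2 + 6 * B := by
  have hT' : (0 : ℝ) < T := by exact_mod_cast hT
  set a : Fin T → ℝ := fun t => h (projIter g c R η D t) x - v
  set b : Fin T → ℝ := fun t =>
    h (projIter g c R η D t) x - inner ℝ (G c x) (projIter g c R η D t)
  have hb : ∀ t, b t ^ 2 ≤ B := fun t => hB _ _ (norm_projIter_sub_le g c hR η D t)
  set e := h (pathAverage g c R η D) x - inner ℝ (G c x) (pathAverage g c R η D)
  have he : e ^ 2 ≤ B := hB _ _ (norm_pathAverage_sub_le g c hR η hT D)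
  have key : h (pathAverage g c R η D) x - v
      -- Averaging commutes with the linearization at the centre `c`, so only the linearization
      -- errors `e` and `b t` separate the network at the average from the average of the networks.
      = (T : ℝ)⁻¹ * ∑ t, a t + e - (T : ℝ)⁻¹ * ∑ t, b t := by
    have h1 : inner ℝ (G c x) (pathAverage g c R η D)
        = (T : ℝ)⁻¹ * ∑ t : Fin T, inner ℝ (G c x) (projIter g c R η D t) := by
      rw [pathAverage, real_inner_smul_right, inner_sum,
        Fin.sum_univ_eq_sum_range (fun t => inner ℝ (G c x) (projIter g c R η D t))]
    simp only [a, b, e, Finset.sum_sub_distrib, h1, Finset.sum_const, Finset.card_univ,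
      Fintype.card_fin, nsmul_eq_mul]
    field_simp
    ring
  have avg : ∀ f : Fin T → ℝ, ((T : ℝ)⁻¹ * ∑ t, f t) ^ 2 ≤ (T : ℝ)⁻¹ * ∑ t, f t ^ 2 := by
    intro f
    have := sq_sum_le_card_mul_sum_sq (s := Finset.univ) (f := f)
    rw [Finset.card_univ, Fintype.card_fin] at this
    calc ((T : ℝ)⁻¹ * ∑ t, f t) ^ 2 = (T : ℝ)⁻¹ ^ 2 * (∑ t, f t) ^ 2 := by ring
      _ ≤ (T : ℝ)⁻¹ ^ 2 * (T * ∑ t, f t ^ 2) := by gcongr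
      _ = (T : ℝ)⁻¹ * ∑ t, f t ^ 2 := by field_simp
  have hbavg : ((T : ℝ)⁻¹ * ∑ t, b t) ^ 2 ≤ B := by
    refine (avg b).trans ?_
    rw [inv_mul_le_iff₀ hT']
    refine (Finset.sum_le_card_nsmul _ _ B fun t _ => hb t).trans ?_
    simp
  have haavg := avg a
  rw [key]
  set u := (T : ℝ)⁻¹ * ∑ t, a t
  set w := (T : ℝ)⁻¹ * ∑ t, b t
  -- The three squares sum to `3 (u² + e² + w²) - (u + e - w)²`.
  nlinarith [sq_nonneg (u - e), sq_nonneg (u + w), sq_nonneg (e + w)]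

/-- The averaged iterate of projected SGD fits a realizable target, up to the linearization
error `B`. -/
theorem lintegral_pathAverage_sq_le [MeasurableSpace E] [BorelSpace E]
    [SecondCountableTopology E] [MeasurableSpace X] (μ : Measure X) [IsProbabilityMeasure μ]
    {h : E → X → ℝ} {G : E → X → E} {y : X → ℝ} {c z : E} {R B : ℝ}
    (hT : 64 ≤ T) (hG : ∀ α x, ‖G α x‖ ≤ 1) (hlin : ∀ α x, h α x = inner ℝ (G α x) α)
    (hh : Measurable fun q : E × X => h q.1 q.2)
    (hGm : Measurable fun q : E × X => G q.1 q.2) (hy : Measurable y)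
    (hz : ‖z - c‖ ≤ R)
    (hB : ∀ α x, ‖α - c‖ ≤ R → (y x - inner ℝ (G α x) z) ^ 2 ≤ B)
    (hB' : ∀ α x, ‖α - c‖ ≤ R → (h α x - inner ℝ (G c x) α) ^ 2 ≤ B) :
    ∫⁻ D, ∫⁻ x, ENNReal.ofReal
        ((h (pathAverage (fun α x => (h α x - y x) • G α x) c R (√(T : ℝ))⁻¹ D) x - y x) ^ 2) ∂μ
        ∂(Measure.pi fun _ : Fin T => μ)
      ≤ ENNReal.ofReal (4 * (R ^ 2 * (√(T : ℝ))⁻¹) + 10 * B) := by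
  classical
  have hR : 0 ≤ R := (norm_nonneg _).trans hz
  have hT0 : 0 < T := by omega
  have hT' : (0 : ℝ) < T := by exact_mod_cast hT0
  have hX : Nonempty X := by
    by_contra hX
    rw [not_nonempty_iff] at hX
    have := measure_univ (μ := μ)
    rw [Set.univ_eq_empty_iff.2 hX, measure_empty] at this
    exact zero_ne_one this
  have hB0 : 0 ≤ B := (sq_nonneg _).trans (hB c hX.some (by simpa using hR))
  set g : E → X → E := fun α x => (h α x - y x) • G α x with hgdef
  have hg : Measurable fun q : E × X => g q.1 q.2 :=
    (hh.sub (hy.comp measurable_snd)).smul hGm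
  set η : ℝ := (√(T : ℝ))⁻¹ with hη
  let F : Fin T → (Fin T → X) → X → ℝ≥0∞ := fun t D x =>
    ENNReal.ofReal ((h (projIter g c R η D t) x - y x) ^ 2)
  have hFm : ∀ t, Measurable fun q : (Fin T → X) × X => F t q.1 q.2 := fun t => by
    refine ENNReal.measurable_ofReal.comp (Measurable.pow_const (Measurable.sub ?_ ?_) 2)
    · exact hh.comp (((measurable_projIter hg c R η t).comp measurable_fst).prodMk measurable_snd)
    · exact hy.comp measurable_snd
  have pointwise : ∀ D x, ENNReal.ofReal ((h (pathAverage g c R η D) x - y x) ^ 2)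
      ≤ ENNReal.ofReal (3 * (T : ℝ)⁻¹) * ∑ t, F t D x + ENNReal.ofReal (6 * B) := by
    intro D x
    have hF : ∑ t, F t D x
        = ENNReal.ofReal (∑ t : Fin T, (h (projIter g c R η D t) x - y x) ^ 2) :=
      (ENNReal.ofReal_sum_of_nonneg fun _ _ => sq_nonneg _).symm
    rw [hF, ← ENNReal.ofReal_mul (by positivity), ← ENNReal.ofReal_add (by positivity)
      (by positivity)]
    refine ENNReal.ofReal_le_ofReal ?_
    exact sq_pathAverage_sub_le g c hR η hT0 hB' D x (y x)
  have hFx : ∀ D t, Measurable fun x => F t D x := fun D t => (hFm t).comp measurable_prodMk_left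
  have hsumm : ∀ D, Measurable fun x => ∑ t, F t D x := fun D =>
    Finset.measurable_sum _ fun t _ => hFx D t
  have hsumF : ∫⁻ D, ∑ t, ∫⁻ x, F t D x ∂μ ∂(Measure.pi fun _ : Fin T => μ)
      ≤ ENNReal.ofReal (8 / 7 * (R ^ 2 * √(T : ℝ) + T * B)) := by
    -- The population losses become losses at the fresh samples, to which the pathwise regret bound
    -- applies.
    rw [lintegral_sum_pi_apply_eq μ hFm fun t D x y => by
      simp only [F, projIter_update_of_le g c R η D t x t le_rfl]]
    calc _ ≤ ∫⁻ D, ENNReal.ofReal (8 / 7 * (R ^ 2 * √(T : ℝ) + T * B))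
          ∂(Measure.pi fun _ : Fin T => μ) := by
          refine lintegral_mono fun D => ?_
          rw [← ENNReal.ofReal_sum_of_nonneg fun _ _ => sq_nonneg _]
          exact ENNReal.ofReal_le_ofReal (sum_sq_projIter_le hT hG hlin hz hB D)
      _ = _ := by simp
  calc _ ≤ ∫⁻ D, (ENNReal.ofReal (3 * (T : ℝ)⁻¹) * ∑ t, ∫⁻ x, F t D x ∂μ
        + ENNReal.ofReal (6 * B)) ∂(Measure.pi fun _ : Fin T => μ) := by
        refine lintegral_mono fun D => ?_
        refine (lintegral_mono fun x => pointwise D x).trans_eq ?_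
        rw [lintegral_add_right _ measurable_const, lintegral_const_mul _ (hsumm D),
          lintegral_finsetSum Finset.univ fun t _ => hFx D t]
        simp
    _ = ENNReal.ofReal (3 * (T : ℝ)⁻¹) * ∫⁻ D, ∑ t, ∫⁻ x, F t D x ∂μ
          ∂(Measure.pi fun _ : Fin T => μ) + ENNReal.ofReal (6 * B) := by
        rw [lintegral_add_right _ measurable_const, lintegral_const_mul]
        · simp
        · exact Finset.measurable_sum _ fun t _ => (hFm t).lintegral_prod_right'
    _ ≤ ENNReal.ofReal (3 * (T : ℝ)⁻¹) * ENNReal.ofReal (8 / 7 * (R ^ 2 * √(T : ℝ) + T * B))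
          + ENNReal.ofReal (6 * B) := by gcongr
    _ ≤ _ := by
        rw [← ENNReal.ofReal_mul (by positivity), ← ENNReal.ofReal_add (by positivity)
          (by positivity)]
        refine ENNReal.ofReal_le_ofReal ?_
        have e1 : (T : ℝ)⁻¹ * √(T : ℝ) = η := by
          rw [hη, inv_mul_eq_div, Real.sqrt_div_self', one_div]
        have e2 : 3 * (T : ℝ)⁻¹ * (8 / 7 * (R ^ 2 * √(T : ℝ) + T * B))
            = 24 / 7 * (R ^ 2 * η) + 24 / 7 * B := by
          rw [← e1]; field_simp; ring
        rw [e2]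
        have : 0 ≤ R ^ 2 * η := by positivity
        -- The constants are `24/7 ≤ 4` and `24/7 + 6 ≤ 10`.
        linarith

end sgd

end NeuralPPO

/-! ### Linearization of two-layer ReLU networks around their initialization -/

namespace NeuralPPO

section network

variable {m d : ℕ}

/-- Euler's identity for the 1-homogeneous ReLU; the convention at the kink is harmless because the
preactivation vanishes there. -/
theorem nn_eq_inner_nnGrad (b : Fin m → ℝ) (α : Weights m d) (x : EuclideanSpace ℝ (Fin d)) :
    nn b α x = inner ℝ (nnGrad b α x) α := by
  rw [nn, PiLp.inner_apply, Finset.mul_sum]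
  refine Finset.sum_congr rfl fun i _ => ?_
  simp only [nnGrad, real_inner_smul_left, real_inner_comm x]
  split_ifs with h
  · rw [max_eq_left h.le]; ring
  · rw [max_eq_right (not_lt.1 h)]; ring

theorem norm_nnGrad_le_one {b : Fin m → ℝ} (hb : ∀ i, |b i| = 1) (α : Weights m d)
    {x : EuclideanSpace ℝ (Fin d)} (hx : ‖x‖ ≤ 1) : ‖nnGrad b α x‖ ≤ 1 := by
  rw [PiLp.norm_eq_of_L2, Real.sqrt_le_iff]
  refine ⟨zero_le_one, ?_⟩
  rw [one_pow]
  calc ∑ i, ‖nnGrad b α x i‖ ^ 2 ≤ ∑ _i : Fin m, (m : ℝ)⁻¹ := by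
        refine Finset.sum_le_sum fun i _ => ?_
        simp only [nnGrad, norm_smul, mul_pow, Real.norm_eq_abs, abs_mul, hb, mul_one]
        rw [abs_of_nonneg (by positivity), inv_pow, Real.sq_sqrt (by positivity)]
        have h1 : ‖x‖ ^ 2 ≤ 1 := pow_le_one₀ (norm_nonneg _) hx
        have h2 : (0 : ℝ) ≤ (m : ℝ)⁻¹ := by positivity
        split_ifs
        · simpa using mul_le_mul_of_nonneg_left h1 h2
        · simp
    _ ≤ 1 := by
        rw [Finset.sum_const, Finset.card_univ, Fintype.card_fin, nsmul_eq_mul]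
        exact mul_inv_le_one

theorem measurable_nn_comp {X : Type*} [MeasurableSpace X] (b : Fin m → ℝ) {f : X → Weights m d}
    {g : X → EuclideanSpace ℝ (Fin d)} (hf : Measurable f) (hg : Measurable g) :
    Measurable fun x => nn b (f x) (g x) := by
  unfold nn
  have : ∀ i, Measurable fun x => f x i := fun i => by fun_prop
  fun_prop

theorem measurable_nnGrad_comp {X : Type*} [MeasurableSpace X] (b : Fin m → ℝ)
    {f : X → Weights m d} {g : X → EuclideanSpace ℝ (Fin d)} (hf : Measurable f)
    (hg : Measurable g) : Measurable fun x => nnGrad b (f x) (g x) := by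
  refine (WithLp.measurable_toLp 2 _).comp (measurable_pi_lambda _ fun i => ?_)
  have hfi : Measurable fun x => f x i := by fun_prop
  have hind : Measurable fun x => if 0 < (inner ℝ (f x i) (g x) : ℝ) then (1 : ℝ) else 0 :=
    Measurable.ite (measurableSet_lt measurable_const (hfi.inner hg)) measurable_const
      measurable_const
  convert! (hind.const_mul ((√(m : ℝ))⁻¹ * b i)).smul hg using 0

/-- Chebyshev's inequality for counting measure: a total displacement `R` leaves few blocks that
move far. -/
theorem card_filter_lt_mul_sq_le {ι E : Type*} [Fintype ι] [NormedAddCommGroup E]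
    (v : PiLp 2 fun _ : ι => E) {R t : ℝ} (ht : 0 ≤ t) (hv : ‖v‖ ≤ R) :
    ((Finset.univ.filter fun i => t < ‖v i‖).card : ℝ) * t ^ 2 ≤ R ^ 2 := by
  calc ((Finset.univ.filter fun i => t < ‖v i‖).card : ℝ) * t ^ 2
      = ∑ _i ∈ Finset.univ.filter fun i => t < ‖v i‖, t ^ 2 := by simp
    _ ≤ ∑ i ∈ Finset.univ.filter fun i => t < ‖v i‖, ‖v i‖ ^ 2 := by
        refine Finset.sum_le_sum fun i hi => ?_
        have := (Finset.mem_filter.1 hi).2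
        gcongr
    _ ≤ ∑ i, ‖v i‖ ^ 2 :=
        Finset.sum_le_sum_of_subset_of_nonneg (Finset.filter_subset _ _) fun _ _ _ => sq_nonneg _
    _ = ‖v‖ ^ 2 := (PiLp.norm_sq_eq_of_L2 _ v).symm
    _ ≤ R ^ 2 := by gcongr

/-- If the activations of `u` and `v` disagree, zero lies between `u` and `v`, so the wrong linear
piece costs at most their distance. -/
theorem abs_max_sub_ite_le {u v : ℝ} :
    |max u 0 - (if 0 < v then 1 else 0) * u| ≤ if (0 < u ↔ 0 < v) then 0 else |u - v| := by
  split_ifs with h1 h2 h2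
  · rw [max_eq_left (h2.2 h1).le]; simp
  · have hu : u ≤ 0 := not_lt.1 fun hu => h2 ⟨fun _ => h1, fun _ => hu⟩
    rw [max_eq_right hu, abs_of_nonneg (by linarith), abs_of_nonpos (by linarith)]
    linarith
  · rw [max_eq_right (not_lt.1 fun hu => h1 (h2.1 hu))]; simp
  · have hu : 0 < u := by tauto
    rw [max_eq_left hu.le, abs_of_nonneg (by linarith), abs_of_nonneg (by linarith)]
    linarith

/-- A neuron contributes only if its activation differs between `α` and `α'`, and then at most `‖(α'
- α) i‖`. Cauchy–Schwarz over these neurons gives their number times `‖α' - α‖² ≤ 4 R²`. A neuron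
can flip only if `|⟪α₀ i, x⟫| ≤ t ‖x‖` or if one of the two weights moved by more than `t`. -/
theorem sq_nn_sub_inner_nnGrad_le {b : Fin m → ℝ} (hb : ∀ i, |b i| = 1)
    {α₀ α α' : Weights m d} {R t : ℝ} (ht : 0 < t) (hα : ‖α - α₀‖ ≤ R) (hα' : ‖α' - α₀‖ ≤ R)
    {x : EuclideanSpace ℝ (Fin d)} (hx : ‖x‖ ≤ 1) :
    (nn b α' x - inner ℝ (nnGrad b α x) α') ^ 2 ≤ 4 * R ^ 2 * ((m : ℝ)⁻¹ *
      ((Finset.univ.filter fun i => |inner ℝ (α₀ i) x| ≤ t * ‖x‖).card + 2 * (R ^ 2 / t ^ 2))) := by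
  classical
  set S := Finset.univ.filter fun i => ¬(0 < (inner ℝ (α' i) x : ℝ) ↔ 0 < (inner ℝ (α i) x : ℝ))
    with hS
  have hdiff : nn b α' x - inner ℝ (nnGrad b α x) α' = (√(m : ℝ))⁻¹ * ∑ i, b i *
      (max (inner ℝ (α' i) x) 0
        - (if 0 < (inner ℝ (α i) x : ℝ) then 1 else 0) * inner ℝ (α' i) x) := by
    rw [nn, PiLp.inner_apply, Finset.mul_sum, Finset.mul_sum, ← Finset.sum_sub_distrib]
    refine Finset.sum_congr rfl fun i _ => ?_
    simp only [nnGrad, real_inner_smul_left, real_inner_comm x]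
    ring
  have hterm : |∑ i, b i * (max (inner ℝ (α' i) x) 0
        - (if 0 < (inner ℝ (α i) x : ℝ) then 1 else 0) * inner ℝ (α' i) x)|
      ≤ ∑ i ∈ S, ‖(α' - α) i‖ := by
    refine (Finset.abs_sum_le_sum_abs _ _).trans ?_
    rw [hS, Finset.sum_filter]
    refine Finset.sum_le_sum fun i _ => ?_
    rw [abs_mul, hb, one_mul]
    refine abs_max_sub_ite_le.trans ?_
    by_cases h : (0 < (inner ℝ (α' i) x : ℝ) ↔ 0 < (inner ℝ (α i) x : ℝ))
    · simp [h]
    · simp only [h, if_false, not_false_eq_true, if_true]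
      rw [← inner_sub_left, ← PiLp.sub_apply]
      exact (abs_real_inner_le_norm _ _).trans (mul_le_of_le_one_right (norm_nonneg _) hx)
  have hCS : (∑ i ∈ S, ‖(α' - α) i‖) ^ 2 ≤ S.card * (4 * R ^ 2) := by
    refine sq_sum_le_card_mul_sum_sq.trans ?_
    gcongr
    calc ∑ i ∈ S, ‖(α' - α) i‖ ^ 2 ≤ ∑ i, ‖(α' - α) i‖ ^ 2 :=
          Finset.sum_le_sum_of_subset_of_nonneg (Finset.subset_univ _) fun _ _ _ => sq_nonneg _
      _ = ‖α' - α‖ ^ 2 := (PiLp.norm_sq_eq_of_L2 _ _).symm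
      _ ≤ (R + R) ^ 2 := by
          gcongr
          calc ‖α' - α‖ = ‖(α' - α₀) - (α - α₀)‖ := by congr 1; abel
            _ ≤ _ := (norm_sub_le _ _).trans (add_le_add hα' hα)
      _ = 4 * R ^ 2 := by ring
  have hsub : S ⊆ (Finset.univ.filter fun i => |inner ℝ (α₀ i) x| ≤ t * ‖x‖)
      ∪ ((Finset.univ.filter fun i => t < ‖(α' - α₀) i‖)
        ∪ Finset.univ.filter fun i => t < ‖(α - α₀) i‖) := by
    intro i hi
    by_contra hcon
    simp only [Finset.mem_union, Finset.mem_filter, Finset.mem_univ, true_and, not_or, not_le,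
      not_lt] at hcon
    obtain ⟨h0, h1, h2⟩ := hcon
    have key : ∀ β : Weights m d, ‖(β - α₀) i‖ ≤ t →
        |inner ℝ (β i) x - inner ℝ (α₀ i) x| ≤ t * ‖x‖ := fun β hβ => by
      rw [← inner_sub_left, ← PiLp.sub_apply]
      exact (abs_real_inner_le_norm _ _).trans (by gcongr)
    have k1 := abs_le.1 (key α' h1)
    have k2 := abs_le.1 (key α h2)
    refine (Finset.mem_filter.1 hi).2 ?_
    rcases lt_abs.1 h0 with h | h
    · exact ⟨fun _ => by linarith, fun _ => by linarith⟩
    · exact ⟨fun _ => by linarith, fun _ => by linarith⟩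
  have hcard : (S.card : ℝ) ≤ (Finset.univ.filter fun i => |inner ℝ (α₀ i) x| ≤ t * ‖x‖).card
      + 2 * (R ^ 2 / t ^ 2) := by
    have h1 := card_filter_lt_mul_sq_le (α' - α₀) ht.le hα'
    have h2 := card_filter_lt_mul_sq_le (α - α₀) ht.le hα
    rw [← le_div_iff₀ (by positivity)] at h1 h2
    have h3 : (S.card : ℝ) ≤ (Finset.univ.filter fun i => |inner ℝ (α₀ i) x| ≤ t * ‖x‖).card
      + ((Finset.univ.filter fun i => t < ‖(α' - α₀) i‖).card
        + (Finset.univ.filter fun i => t < ‖(α - α₀) i‖).card) := by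
      exact_mod_cast (Finset.card_le_card hsub).trans ((Finset.card_union_le _ _).trans
        (Nat.add_le_add_left (Finset.card_union_le _ _) _))
    linarith
  rw [hdiff, mul_pow, inv_pow, Real.sq_sqrt (by positivity), ← sq_abs (∑ i, _)]
  calc (m : ℝ)⁻¹ * |∑ i, b i * (max (inner ℝ (α' i) x) 0
        - (if 0 < (inner ℝ (α i) x : ℝ) then 1 else 0) * inner ℝ (α' i) x)| ^ 2
      ≤ (m : ℝ)⁻¹ * (S.card * (4 * R ^ 2)) := by
        gcongr
        exact (pow_le_pow_left₀ (abs_nonneg _) hterm 2).trans hCS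
    _ ≤ (m : ℝ)⁻¹ * (((Finset.univ.filter fun i => |inner ℝ (α₀ i) x| ≤ t * ‖x‖).card
      + 2 * (R ^ 2 / t ^ 2)) * (4 * R ^ 2)) := by gcongr
    _ = _ := by ring

end network

end NeuralPPO

/-! ### Uniform anti-concentration of the Gaussian initialization -/

namespace NeuralPPO

theorem gaussianReal_abs_le_le {v : NNReal} (hv : v ≠ 0) (s : ℝ) :
    gaussianReal 0 v {y | |y| ≤ s} ≤ ENNReal.ofReal (s / √(v : ℝ)) := by
  have hv' : (0 : ℝ) < v := by positivity
  have hset : {y : ℝ | |y| ≤ s} = Set.Icc (-s) s := by ext y; simp [abs_le]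
  -- The density is at most `1/√(2πv) ≤ 1/(2√v)`, and the interval has length `2s`.
  have hpdf : ∀ y, gaussianPDF 0 v y ≤ ENNReal.ofReal ((2 * √(v : ℝ))⁻¹) := fun y => by
    refine ENNReal.ofReal_le_ofReal ?_
    rw [gaussianPDFReal]
    refine (mul_le_of_le_one_right (by positivity) (Real.exp_le_one_iff.2 ?_)).trans ?_
    · exact div_nonpos_of_nonpos_of_nonneg (neg_nonpos.2 (sq_nonneg _)) (by positivity)
    · refine inv_anti₀ (by positivity) ?_
      refine Real.le_sqrt_of_sq_le ?_
      rw [mul_pow, Real.sq_sqrt hv'.le]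
      nlinarith [Real.pi_gt_three]
  rw [hset, gaussianReal_apply _ hv]
  calc ∫⁻ y in Set.Icc (-s) s, gaussianPDF 0 v y
      ≤ ∫⁻ _ in Set.Icc (-s) s, ENNReal.ofReal ((2 * √(v : ℝ))⁻¹) := lintegral_mono hpdf
    _ = ENNReal.ofReal (s / √(v : ℝ)) := by
        rw [setLIntegral_const, Real.volume_Icc, ← ENNReal.ofReal_mul (by positivity)]
        congr 1
        field_simp
        ring

instance (d : ℕ) : IsProbabilityMeasure (initGaussian d) :=
  Measure.isProbabilityMeasure_map (by fun_prop)

theorem stdGaussian_map_inner (d : ℕ) (z : EuclideanSpace ℝ (Fin d)) :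
    (stdGaussian (EuclideanSpace ℝ (Fin d))).map (fun α => inner ℝ α z)
      = gaussianReal 0 (‖z‖₊ ^ 2) := by
  have h := IsGaussian.map_eq_gaussianReal (μ := stdGaussian (EuclideanSpace ℝ (Fin d)))
    (innerSL ℝ z)
  rw [variance_dual_stdGaussian, integral_strongDual_stdGaussian, innerSL_apply_norm] at h
  have h2 : (‖z‖ ^ 2).toNNReal = ‖z‖₊ ^ 2 := by
    rw [Real.toNNReal_pow (norm_nonneg _), norm_toNNReal]
  rw [h2] at h
  rw [← h]
  congr 1
  ext α
  exact real_inner_comm _ _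

theorem initGaussian_abs_inner_le_le {d : ℕ} (hd : 0 < d) {z : EuclideanSpace ℝ (Fin d)}
    (hz : z ≠ 0) (s : ℝ) :
    initGaussian d {α | |inner ℝ α z| ≤ s} ≤ ENNReal.ofReal (s * √(d : ℝ) / ‖z‖) := by
  have hd' : (0 : ℝ) < √(d : ℝ) := by positivity
  have hm : MeasurableSet {y : ℝ | |y| ≤ s * √(d : ℝ)} :=
    measurableSet_le (by fun_prop) measurable_const
  have hset : (fun α : EuclideanSpace ℝ (Fin d) => (√(d : ℝ))⁻¹ • α) ⁻¹' {α | |inner ℝ α z| ≤ s}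
      = (fun α => (inner ℝ α z : ℝ)) ⁻¹' {y : ℝ | |y| ≤ s * √(d : ℝ)} := by
    ext α
    simp only [Set.mem_preimage, Set.mem_ofPred_eq, real_inner_smul_left, abs_mul, abs_inv,
      abs_of_pos hd']
    rw [inv_mul_le_iff₀ hd', mul_comm]
  rw [initGaussian, Measure.map_apply (by fun_prop)
    (measurableSet_le (by fun_prop) measurable_const), hset,
    ← Measure.map_apply (by fun_prop) hm, stdGaussian_map_inner]
  refine (gaussianReal_abs_le_le (by simpa using hz) _).trans_eq ?_
  simp

/-- Markov's inequality for the finite second moment; the quadratic decay is enough at the level `L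
= r^{-1/2}` used below. -/
theorem exists_initGaussian_norm_tail (d : ℕ) : ∃ C : ℝ, 0 < C ∧ ∀ L : ℝ, 0 < L →
    initGaussian d {α | L < ‖α‖} ≤ ENNReal.ofReal (C / L ^ 2) := by
  have hL2 : MemLp id 2 (initGaussian d) := by
    rw [initGaussian, memLp_map_measure_iff (by fun_prop) (by fun_prop)]
    exact (IsGaussian.memLp_two_id (μ := stdGaussian (EuclideanSpace ℝ (Fin d)))).const_smul (√(d : ℝ))⁻¹
  have hfin : ∫⁻ α, ENNReal.ofReal (‖α‖ ^ 2) ∂(initGaussian d) < ∞ := by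
    have := (hL2.integrable_norm_pow (by norm_num)).lintegral_lt_top
    simpa using this
  set I := ∫⁻ α, ENNReal.ofReal (‖α‖ ^ 2) ∂(initGaussian d) with hI
  refine ⟨I.toReal + 1, by positivity, fun L hL => ?_⟩
  calc initGaussian d {α | L < ‖α‖}
      ≤ initGaussian d {α | ENNReal.ofReal (L ^ 2) ≤ ENNReal.ofReal (‖α‖ ^ 2)} := by
        refine measure_mono fun α (hα : L < ‖α‖) => ENNReal.ofReal_le_ofReal ?_
        gcongr
    _ ≤ I / ENNReal.ofReal (L ^ 2) :=
        meas_ge_le_lintegral_div (by fun_prop) (by simpa using hL.ne') ENNReal.ofReal_ne_top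
    _ ≤ ENNReal.ofReal ((I.toReal + 1) / L ^ 2) := by
        rw [ENNReal.ofReal_div_of_pos (by positivity)]
        gcongr
        rw [← ENNReal.ofReal_toReal hfin.ne]
        exact ENNReal.ofReal_le_ofReal (by simp)

theorem ofReal_exp_card_filter {ι Ω : Type*} [Fintype ι] (p : Ω → Prop) [DecidablePred p]
    (ω : ι → Ω) : ENNReal.ofReal (Real.exp ((Finset.univ.filter fun i => p (ω i)).card))
      = ∏ i, if p (ω i) then ENNReal.ofReal (Real.exp 1) else 1 := by
  rw [Finset.prod_ite, Finset.prod_const, Finset.prod_const_one, mul_one,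
    ← ENNReal.ofReal_pow (Real.exp_pos 1).le, ← Real.exp_nat_mul, mul_one]

/-- The exponential moment of the number of successes in independent trials. -/
theorem lintegral_pi_prod_ite_le {ι Ω : Type*} [Fintype ι] [MeasurableSpace Ω] (P : Measure Ω)
    [IsProbabilityMeasure P] {p : Ω → Prop} [DecidablePred p] (hp : MeasurableSet {ω | p ω})
    {q : ℝ} (hq : 0 ≤ q) (hPq : P {ω | p ω} ≤ ENNReal.ofReal q) :
    ∫⁻ ω, ∏ i, (if p (ω i) then ENNReal.ofReal (Real.exp 1) else 1)
        ∂(Measure.pi fun _ : ι => P)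
      ≤ ENNReal.ofReal (Real.exp (2 * Fintype.card ι * q)) := by
  have hm : Measurable fun ω : Ω => if p ω then ENNReal.ofReal (Real.exp 1) else 1 :=
    Measurable.ite hp measurable_const measurable_const
  have hone : ∫⁻ ω, (if p ω then ENNReal.ofReal (Real.exp 1) else 1) ∂P
      ≤ ENNReal.ofReal (Real.exp (2 * q)) := by
    calc ∫⁻ ω, (if p ω then ENNReal.ofReal (Real.exp 1) else 1) ∂P
        ≤ ∫⁻ ω, (1 + {ω | p ω}.indicator (fun _ => 2) ω) ∂P := by
          refine lintegral_mono fun ω => ?_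
          by_cases h : p ω
          · simp only [h, if_true, Set.indicator, Set.mem_ofPred_eq]
            calc ENNReal.ofReal (Real.exp 1) ≤ ENNReal.ofReal 3 :=
                  ENNReal.ofReal_le_ofReal (by linarith [Real.exp_one_lt_d9])
              _ = 1 + 2 := by norm_num
          · simp [h]
      _ = 1 + 2 * P {ω | p ω} := by
          rw [lintegral_add_left measurable_const, lintegral_indicator_const hp]
          simp
      _ ≤ 1 + 2 * ENNReal.ofReal q := by gcongr
      _ = ENNReal.ofReal (1 + 2 * q) := by
          rw [ENNReal.ofReal_add zero_le_one (by positivity), ENNReal.ofReal_mul zero_le_two]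
          simp
      _ ≤ ENNReal.ofReal (Real.exp (2 * q)) :=
          ENNReal.ofReal_le_ofReal (by linarith [Real.add_one_le_exp (2 * q)])
  rw [lintegral_prod_eq_prod_lintegral_of_indepFun Finset.univ
    (fun (i : ι) (ω : ι → Ω) => if p (ω i) then ENNReal.ofReal (Real.exp 1) else 1)
    (iIndepFun_pi (X := fun _ : ι => fun ω : Ω => if p ω then ENNReal.ofReal (Real.exp 1) else 1)
      fun _ => hm.aemeasurable) fun i => hm.comp (measurable_pi_apply i)]
  calc ∏ i : ι, ∫⁻ ω : ι → Ω, (if p (ω i) then ENNReal.ofReal (Real.exp 1) else 1)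
        ∂(Measure.pi fun _ : ι => P)
      ≤ ∏ _i : ι, ENNReal.ofReal (Real.exp (2 * q)) := by
        refine Finset.prod_le_prod' fun i _ => ?_
        rw [← (measurePreserving_eval (fun _ : ι => P) i).lintegral_comp hm] at hone
        exact hone
    _ = _ := by
        rw [Finset.prod_const, Finset.card_univ, ← ENNReal.ofReal_pow (Real.exp_pos _).le,
          ← Real.exp_nat_mul]
        congr 2
        ring

/-! ### Counting nearly orthogonal neurons uniformly over directions. -/

section count

variable {m d : ℕ}

/-- The exponential moment of the number of nearly orthogonal neurons is bounded uniformly over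
all directions, after discarding the neurons of large norm. -/
theorem exists_uniform_exp_count (hd : 0 < d) {ε L t : ℝ} (hε : 0 < ε) (hε' : ε ≤ 1 / 2)
    (ht : 0 < t) (hεL : ε * L ≤ t) :
    ∃ Z : (Fin m → EuclideanSpace ℝ (Fin d)) → ℝ≥0∞, Measurable Z ∧
      (∀ α x, ‖x‖ = 1 → ENNReal.ofReal (Real.exp
        ((Finset.univ.filter fun i => |inner ℝ (α i) x| ≤ t).card
          - (Finset.univ.filter fun i => L < ‖α i‖).card)) ≤ Z α) ∧
      ∫⁻ α, Z α ∂(Measure.pi fun _ => initGaussian d)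
        ≤ ENNReal.ofReal ((2 / ε) ^ d * Real.exp (8 * m * t * √(d : ℝ))) := by
  classical
  let E := EuclideanSpace ℝ (Fin d)
  -- An annulus that contains every ball of radius `ε ≤ 1/2` around a unit vector and stays away
  -- from the origin, where anti-concentration fails.
  set A : Set E := Metric.ball 0 2 \ Metric.ball 0 (1 / 2) with hA
  have hAm : MeasurableSet A :=
    Metric.isOpen_ball.measurableSet.diff Metric.isOpen_ball.measurableSet
  let f : (Fin m → E) → E → ℝ≥0∞ := fun α x =>
    ∏ i, if |inner ℝ (α i) x| ≤ 2 * t then ENNReal.ofReal (Real.exp 1) else 1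
  have hf : Measurable (Function.uncurry f) := by
    refine Finset.measurable_prod _ fun i _ => ?_
    refine Measurable.ite (measurableSet_le ?_ measurable_const) measurable_const measurable_const
    exact Continuous.measurable (by fun_prop)
  set V := volume (Metric.ball (0 : E) ε) with hV
  have hV0 : V ≠ 0 := (Metric.measure_ball_pos _ _ hε).ne'
  have hVtop : V ≠ ∞ := measure_ball_lt_top.ne
  -- The supremum over directions is replaced by an integral: up to the neurons longer than `L`, the
  -- count at `x` with threshold `t` is at most the count at any `y` within `ε` with threshold `2t`,
  -- since `ε L ≤ t`. Averaging over the ball around `x` then costs only the volume ratio, at most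
  -- `(2/ε)^d`.
  refine ⟨fun α => V⁻¹ * ∫⁻ x in A, f α x, ?_, fun α x hx => ?_, ?_⟩
  · exact Measurable.const_mul hf.lintegral_prod_right' _
  · change _ ≤ V⁻¹ * ∫⁻ x in A, f α x
    rw [← ENNReal.div_eq_inv_mul, ENNReal.le_div_iff_mul_le (Or.inl hV0) (Or.inl hVtop)]
    have hsub : Metric.ball x ε ⊆ A := by
      intro y hy
      rw [Metric.mem_ball, dist_eq_norm] at hy
      have h1 : ‖y‖ ≤ ‖y - x‖ + ‖x‖ := norm_le_norm_sub_add y x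
      have h2 : ‖x‖ ≤ ‖y - x‖ + ‖y‖ := by
        rw [← norm_neg (y - x), neg_sub]; exact norm_le_norm_sub_add x y
      rw [hA, Set.mem_sdiff, mem_ball_zero_iff, mem_ball_zero_iff]
      constructor <;> linarith
    have hball : V = volume (Metric.ball x ε) := (Measure.addHaar_ball_center _ _ _).symm
    rw [hball, ← setLIntegral_const]
    refine (setLIntegral_mono' Metric.isOpen_ball.measurableSet fun y hy => ?_).trans
      (lintegral_mono_set hsub)
    change _ ≤ ∏ i, if |inner ℝ (α i) y| ≤ 2 * t then ENNReal.ofReal (Real.exp 1) else 1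
    rw [← ofReal_exp_card_filter (fun v : E => |inner ℝ v y| ≤ 2 * t) α]
    refine ENNReal.ofReal_le_ofReal (Real.exp_le_exp.2 ?_)
    rw [sub_le_iff_le_add]
    have hcard : (Finset.univ.filter fun i => |inner ℝ (α i) x| ≤ t)
        ⊆ (Finset.univ.filter fun i => |inner ℝ (α i) y| ≤ 2 * t)
          ∪ Finset.univ.filter fun i => L < ‖α i‖ := by
      intro i hi
      simp only [Finset.mem_union, Finset.mem_filter, Finset.mem_univ, true_and] at hi ⊢
      by_contra! hcon
      have h1 : |inner ℝ (α i) (y - x)| ≤ t := by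
        refine (abs_real_inner_le_norm _ _).trans ?_
        rw [Metric.mem_ball, dist_eq_norm] at hy
        calc ‖α i‖ * ‖y - x‖ ≤ L * ε := by
              have := (norm_nonneg (α i)).trans hcon.2
              gcongr
              exact hcon.2
          _ ≤ t := by rwa [mul_comm]
      rw [inner_sub_right] at h1
      have h2 := abs_sub_abs_le_abs_sub (inner ℝ (α i) y : ℝ) (inner ℝ (α i) x)
      linarith [hcon.1]
    exact_mod_cast (Finset.card_le_card hcard).trans (Finset.card_union_le _ _)
  · have hfm : Measurable fun α => ∫⁻ x in A, f α x := hf.lintegral_prod_right'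
    rw [lintegral_const_mul _ hfm, lintegral_lintegral_swap hf.aemeasurable]
    have hin : ∀ x ∈ A, ∫⁻ α, f α x ∂(Measure.pi fun _ : Fin m => initGaussian d)
        ≤ ENNReal.ofReal (Real.exp (8 * m * t * √(d : ℝ))) := by
      intro x hx
      have hx1 : 1 / 2 ≤ ‖x‖ := by
        have := hx.2
        rwa [mem_ball_zero_iff, not_lt] at this
      have hx0 : x ≠ 0 := norm_pos_iff.1 (by linarith)
      have hq : initGaussian d {v | |inner ℝ v x| ≤ 2 * t}
          ≤ ENNReal.ofReal (4 * t * √(d : ℝ)) := by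
        refine (initGaussian_abs_inner_le_le hd hx0 _).trans
          (ENNReal.ofReal_le_ofReal ?_)
        -- The factor 4 combines the doubled threshold with `‖x‖ ≥ 1/2`.
        rw [div_le_iff₀ (by linarith)]
        have : 0 ≤ t * √(d : ℝ) := by positivity
        nlinarith
      refine (lintegral_pi_prod_ite_le (ι := Fin m) (initGaussian d)
        (p := fun v => |inner ℝ v x| ≤ 2 * t)
        (measurableSet_le (by fun_prop) measurable_const) (by positivity) hq).trans_eq ?_
      rw [Fintype.card_fin]
      congr 2
      ring
    calc V⁻¹ * ∫⁻ x in A, ∫⁻ α, f α x ∂(Measure.pi fun _ : Fin m => initGaussian d)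
        ≤ V⁻¹ * ∫⁻ _ in Metric.ball (0 : E) 2,
            ENNReal.ofReal (Real.exp (8 * m * t * √(d : ℝ))) := by
          exact mul_le_mul' le_rfl
            ((setLIntegral_mono' hAm hin).trans (lintegral_mono_set Set.sdiff_subset))
      _ = _ := by
          have h2 : (2 : ℝ) = 2 / ε * ε := by field_simp
          have hvol : volume (Metric.ball (0 : E) 2) = ENNReal.ofReal ((2 / ε) ^ d) * V := by
            conv_lhs => rw [h2]
            rw [Measure.addHaar_ball_mul_of_pos _ _ (by positivity), finrank_euclideanSpace_fin]
          rw [setLIntegral_const, hvol, ENNReal.ofReal_mul (by positivity), mul_comm _ V,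
            mul_left_comm, ← mul_assoc V⁻¹ V, ENNReal.inv_mul_cancel hV0 hVtop, one_mul, mul_comm]

theorem lintegral_pi_card_filter_le {Ω : Type*} [MeasurableSpace Ω] (P : Measure Ω)
    [IsProbabilityMeasure P] {p : Ω → Prop} [DecidablePred p] (hp : MeasurableSet {ω | p ω}) :
    ∫⁻ ω, ((Finset.univ.filter fun i => p (ω i)).card : ℝ≥0∞) ∂(Measure.pi fun _ : Fin m => P)
      = m * P {ω | p ω} := by
  have hm : Measurable fun ω : Ω => if p ω then (1 : ℝ≥0∞) else 0 :=
    Measurable.ite hp measurable_const measurable_const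
  have hone : ∫⁻ ω, (if p ω then (1 : ℝ≥0∞) else 0) ∂P = P {ω | p ω} := by
    have : (fun ω => if p ω then (1 : ℝ≥0∞) else 0) = {ω | p ω}.indicator fun _ => 1 := by
      ext ω; simp [Set.indicator]
    rw [this, lintegral_indicator_const hp, one_mul]
  have hi : ∀ i : Fin m, ∫⁻ ω : Fin m → Ω, (if p (ω i) then (1 : ℝ≥0∞) else 0)
      ∂(Measure.pi fun _ : Fin m => P) = P {ω | p ω} := fun i => by
    rw [← hone]
    exact (measurePreserving_eval (fun _ : Fin m => P) i).lintegral_comp hm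
  simp only [Finset.card_filter, Nat.cast_sum, Nat.cast_ite, Nat.cast_one, Nat.cast_zero]
  have hmi : ∀ i : Fin m, Measurable fun ω : Fin m → Ω => if p (ω i) then (1 : ℝ≥0∞) else 0 :=
    fun i => hm.comp (measurable_pi_apply i)
  rw [lintegral_finsetSum Finset.univ fun i _ => hmi i]
  simp [hi]

/-- The expectation of the largest number of nearly orthogonal neurons, over all directions. -/
theorem exists_uniform_count (hd : 0 < d) {ε L t : ℝ} (hε : 0 < ε) (hε' : ε ≤ 1 / 2)
    (ht : 0 < t) (hεL : ε * L ≤ t) :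
    ∃ W : (Fin m → EuclideanSpace ℝ (Fin d)) → ℝ≥0∞, Measurable W ∧
      (∀ α x, ‖x‖ = 1 → ((Finset.univ.filter fun i => |inner ℝ (α i) x| ≤ t).card : ℝ≥0∞) ≤ W α) ∧
      ∫⁻ α, W α ∂(Measure.pi fun _ => initGaussian d)
        ≤ m * initGaussian d {v | L < ‖v‖} + 1
          + ENNReal.ofReal (d * Real.log (2 / ε) + 8 * m * t * √(d : ℝ)) := by
  obtain ⟨Z, hZm, hZ, hZint⟩ := exists_uniform_exp_count (m := m) hd hε hε' ht hεL
  set a : ℝ := (2 / ε) ^ d * Real.exp (8 * m * t * √(d : ℝ)) with ha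
  have ha0 : 0 < a := by positivity
  have hloga : Real.log a = d * Real.log (2 / ε) + 8 * m * t * √(d : ℝ) := by
    rw [ha, Real.log_mul (by positivity) (by positivity), Real.log_exp, Real.log_pow]
  have hlog0 : 0 ≤ Real.log a := by
    rw [hloga]
    have : 0 ≤ Real.log (2 / ε) := Real.log_nonneg (by rw [le_div_iff₀ hε]; linarith)
    positivity
  have hMm : Measurable fun α : Fin m → EuclideanSpace ℝ (Fin d) =>
      ((Finset.univ.filter fun i => L < ‖α i‖).card : ℝ≥0∞) := by
    simp only [Finset.card_filter, Nat.cast_sum, Nat.cast_ite, Nat.cast_one, Nat.cast_zero]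
    exact Finset.measurable_sum _ fun i _ =>
      Measurable.ite (measurableSet_lt measurable_const (by fun_prop)) measurable_const
        measurable_const
  -- From `u + 1 ≤ exp u` at `u = N - M - log a`, one gets `N ≤ M + exp (N - M) / a + log a`. Since
  -- `a` bounds the mean of `Z`, the middle term has mean at most 1.
  refine ⟨fun α => (Finset.univ.filter fun i => L < ‖α i‖).card + Z α / ENNReal.ofReal a
    + ENNReal.ofReal (Real.log a), ?_, fun α x hx => ?_, ?_⟩
  · exact (hMm.add (hZm.div_const _)).add_const _
  · set N := (Finset.univ.filter fun i => |inner ℝ (α i) x| ≤ t).card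
    set M := (Finset.univ.filter fun i => L < ‖α i‖).card
    have h1 : (N : ℝ) ≤ M + Real.exp ((N : ℝ) - M) / a + Real.log a := by
      have := Real.add_one_le_exp ((N : ℝ) - M - Real.log a)
      rw [Real.exp_sub, Real.exp_log ha0] at this
      linarith
    have h2 := ENNReal.ofReal_le_ofReal h1
    rw [ENNReal.ofReal_natCast, ENNReal.ofReal_add (by positivity) hlog0,
      ENNReal.ofReal_add (by positivity) (by positivity), ENNReal.ofReal_natCast,
      ENNReal.ofReal_div_of_pos ha0] at h2
    change (N : ℝ≥0∞) ≤ M + Z α / ENNReal.ofReal a + ENNReal.ofReal (Real.log a)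
    refine h2.trans ?_
    gcongr
    exact hZ α x hx
  · rw [lintegral_add_right _ measurable_const, lintegral_add_left hMm,
      lintegral_pi_card_filter_le _ (measurableSet_lt measurable_const measurable_norm),
      lintegral_const, measure_univ, mul_one, hloga]
    gcongr
    simp only [div_eq_mul_inv]
    rw [lintegral_mul_const _ hZm, ← div_eq_mul_inv]
    refine ENNReal.div_le_of_le_mul ?_
    rwa [one_mul]

/-- The number of neurons that are nearly orthogonal to some direction is at most of order
`m (√r + r)` in expectation, where `r = R / √m`. -/
theorem exists_uniform_count_le (hd : 0 < d) {r₀ : ℝ} (hr₀ : 0 < r₀) :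
    ∃ C : ℝ, 0 < C ∧ ∀ (m : ℕ) (R : ℝ), 1 ≤ m → r₀ ≤ R →
      ∃ W : (Fin m → EuclideanSpace ℝ (Fin d)) → ℝ≥0∞, Measurable W ∧
        (∀ α x, ‖x‖ = 1 →
          ((Finset.univ.filter fun i => |inner ℝ (α i) x| ≤ √(R / √(m : ℝ))).card : ℝ≥0∞) ≤ W α) ∧
        ∫⁻ α, W α ∂(Measure.pi fun _ => initGaussian d)
          ≤ ENNReal.ofReal (C * (m * (√(R / √(m : ℝ)) + R / √(m : ℝ)))) := by
  obtain ⟨C₂, hC₂, htail⟩ := exists_initGaussian_norm_tail d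
  refine ⟨2 + C₂ + 1 / r₀ + d * (2 / r₀ ^ 2) + 8 * √(d : ℝ), by positivity, fun m R hm hR => ?_⟩
  have hm' : (1 : ℝ) ≤ m := by exact_mod_cast hm
  have hm0 : (0 : ℝ) < m := by linarith
  have hR0 : 0 < R := by linarith
  have hsm : 1 ≤ √(m : ℝ) := Real.one_le_sqrt.2 hm'
  set r := R / √(m : ℝ) with hr
  have hr0 : 0 < r := by positivity
  have hmr : m * r = R * √(m : ℝ) := by
    rw [hr]
    field_simp
    rw [Real.sq_sqrt hm0.le]
  have hone : 1 ≤ m * r * (1 / r₀) := by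
    rw [mul_one_div, le_div_iff₀ hr₀, hmr]
    nlinarith
  by_cases hcase : r ≤ 1 / 2
  -- With `ε = r`, `L = r^{-1/2}` and `t = √r`, `ε L = t` holds with equality and the long neurons
  -- contribute only `C₂ m r`.
  · obtain ⟨W, hWm, hW, hWint⟩ := exists_uniform_count (m := m) hd (ε := r) (L := (√r)⁻¹)
      (t := √r) hr0 hcase (by positivity) (by
        rw [← div_eq_mul_inv, Real.div_sqrt])
    refine ⟨W, hWm, hW, hWint.trans ?_⟩
    have h1 : initGaussian d {v | (√r)⁻¹ < ‖v‖} ≤ ENNReal.ofReal (C₂ * r) := by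
      refine (htail _ (by positivity)).trans_eq ?_
      rw [inv_pow, Real.sq_sqrt hr0.le, div_inv_eq_mul]
    -- A crude bound on the logarithm is enough: `2/r = 2√m/R`, while `m r = R√m`, and `R ≥ r₀`.
    have hlog : Real.log (2 / r) ≤ m * r * (2 / r₀ ^ 2) := by
      have e1 : 2 / r = 2 * √(m : ℝ) / R := by rw [hr]; field_simp
      have e2 : 2 / r ≤ m * r * (2 / r₀ ^ 2) := by
        rw [hmr, e1, div_le_iff₀ hR0]
        have : 1 ≤ R ^ 2 / r₀ ^ 2 := by
          rw [one_le_div (by positivity)]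
          gcongr
        calc 2 * √(m : ℝ) = 2 * √(m : ℝ) * 1 := by ring
          _ ≤ 2 * √(m : ℝ) * (R ^ 2 / r₀ ^ 2) := by gcongr
          _ = _ := by ring
      exact (Real.log_le_self (by positivity)).trans e2
    have hlog0 : 0 ≤ Real.log (2 / r) := Real.log_nonneg (by rw [le_div_iff₀ hr0]; linarith)
    calc (m : ℝ≥0∞) * initGaussian d {v | (√r)⁻¹ < ‖v‖} + 1
          + ENNReal.ofReal (d * Real.log (2 / r) + 8 * m * √r * √(d : ℝ))
        ≤ ENNReal.ofReal m * ENNReal.ofReal (C₂ * r) + ENNReal.ofReal 1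
          + ENNReal.ofReal (d * Real.log (2 / r) + 8 * m * √r * √(d : ℝ)) := by
          rw [ENNReal.ofReal_natCast, ENNReal.ofReal_one]
          gcongr
      _ = ENNReal.ofReal (m * (C₂ * r) + 1
          + (d * Real.log (2 / r) + 8 * m * √r * √(d : ℝ))) := by
          rw [← ENNReal.ofReal_mul hm0.le, ← ENNReal.ofReal_add (by positivity) (by positivity),
            ← ENNReal.ofReal_add (by positivity) (by positivity)]
      _ ≤ _ := by
          refine ENNReal.ofReal_le_ofReal ?_
          have h3 : (d : ℝ) * Real.log (2 / r) ≤ d * (m * r * (2 / r₀ ^ 2)) := by gcongr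
          have h4 : 0 ≤ m * r := by positivity
          have h5 : 0 ≤ m * √r := by positivity
          have h6 : 0 ≤ (2 + C₂ + 1 / r₀ + d * (2 / r₀ ^ 2)) * (m * √r) := by positivity
          have h7 : 0 ≤ 8 * √(d : ℝ) * (m * r) := by positivity
          linarith
  -- For `r > 1/2` the trivial count `m` is already at most `2 m r`.
  · refine ⟨fun _ => m, measurable_const, fun α x _ => ?_, ?_⟩
    · exact Nat.cast_le.2 ((Finset.card_filter_le _ _).trans_eq (by
        rw [Finset.card_univ, Fintype.card_fin]))
    · rw [lintegral_const, measure_univ, mul_one, ← ENNReal.ofReal_natCast]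
      refine ENNReal.ofReal_le_ofReal ?_
      push Not at hcase
      have h1 : (m : ℝ) ≤ 2 * (m * (√r + r)) := by
        have : 0 ≤ m * √r := by positivity
        nlinarith
      refine h1.trans ?_
      gcongr
      have : 0 ≤ C₂ + 1 / r₀ + d * (2 / r₀ ^ 2) + 8 * √(d : ℝ) := by positivity
      linarith

end count

end NeuralPPO

/-! ### Policy improvement in neural PPO -/

namespace NeuralPPO

/-- The factors `β √K` cancel. At `k = 0` the value `τ_0 = 1` breaks the pattern, which is harmless
because the energy `v` is then zero. -/
theorem Params.τ_succ_mul {p : Params} {k : ℕ} (hk : k < p.K) (u v : ℝ) (hv : k = 0 → v = 0) :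
    p.τ (k + 1) * (p.βk⁻¹ * u + (p.τ k)⁻¹ * v)
      = 1 / ((k : ℝ) + 1) * u + k / ((k : ℝ) + 1) * v := by
  have hβ := p.β_pos
  have hK : (0 : ℝ) < √(p.K : ℝ) := by
    have : (0 : ℝ) < p.K := by exact_mod_cast (Nat.zero_le k).trans_lt hk
    positivity
  cases k with
  | zero =>
    simp only [Params.τ, Params.βk, hv rfl]
    field_simp
    simp
  | succ k =>
    simp only [Params.τ, Params.βk]
    push_cast
    field_simp

section

variable {S A : Type*} [MeasurableSpace S] [MeasurableSpace A] {m d : ℕ}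

/-- The target of policy improvement is a convex combination of two networks. -/
theorem target_eq (M : MDP S A d) {p : Params} {k : ℕ} (hk : k < p.K) (b : Fin m → ℝ)
    (θ ω : Weights m d) (x : S × A) :
    target M p k b θ ω x
      = 1 / ((k : ℝ) + 1) * nn b ω (M.vec x) + k / ((k : ℝ) + 1) * nn b θ (M.vec x) := by
  rw [target, Params.τ_succ_mul hk _ _ fun h => by simp [energy, h]]
  by_cases h : k = 0
  · simp [h]
  · simp [energy, h]

theorem measurable_target (M : MDP S A d) {p : Params} {k : ℕ} (hk : k < p.K) (b : Fin m → ℝ)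
    (θ ω : Weights m d) : Measurable (target M p k b θ ω) := by
  rw [funext (target_eq M hk b θ ω)]
  exact (((measurable_nn _ _).comp M.measurable_vec).const_mul _).add
    (((measurable_nn _ _).comp M.measurable_vec).const_mul _)

/-- In the linearized network class, the target of policy improvement is realized by a point of
the ball. -/
theorem exists_target_approx (M : MDP S A d) {p : Params} {k : ℕ} (hk : k < p.K) {b : Fin m → ℝ}
    {c θ ω : Weights m d} {R B : ℝ} (hθ : ‖θ - c‖ ≤ R) (hω : ‖ω - c‖ ≤ R)
    (hB : ∀ α α' : Weights m d, ‖α - c‖ ≤ R → ‖α' - c‖ ≤ R →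
      ∀ x : EuclideanSpace ℝ (Fin d), ‖x‖ ≤ 1 →
        (nn b α' x - inner ℝ (nnGrad b α x) α') ^ 2 ≤ B) :
    ∃ z : Weights m d, ‖z - c‖ ≤ R ∧ ∀ α x, ‖α - c‖ ≤ R →
      (target M p k b θ ω x - inner ℝ (nnGrad b α (M.vec x)) z) ^ 2 ≤ B := by
  obtain ⟨l, l', hl, hl', hadd, ht⟩ : ∃ l l' : ℝ, 0 ≤ l ∧ 0 ≤ l' ∧ l + l' = 1 ∧
      ∀ x, target M p k b θ ω x = l * nn b ω (M.vec x) + l' * nn b θ (M.vec x) :=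
    ⟨1 / ((k : ℝ) + 1), k / ((k : ℝ) + 1), by positivity, by positivity, by field_simp; ring,
      target_eq M hk b θ ω⟩
  -- One `z` serves every `α`: the same convex combination is taken of the weights as of the
  -- networks, and convexity of the square keeps the error at `B`.
  refine ⟨l • ω + l' • θ, ?_, fun α x hα => ?_⟩
  · exact mem_closedBall_iff_norm.1 ((convex_closedBall c R) (mem_closedBall_iff_norm.2 hω)
      (mem_closedBall_iff_norm.2 hθ) hl hl' hadd)
  · rw [ht, inner_add_right, real_inner_smul_right, real_inner_smul_right]
    have h1 := hB α ω hα hω _ (M.norm_vec_le_one x)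
    have h2 := hB α θ hα hθ _ (M.norm_vec_le_one x)
    generalize nn b ω (M.vec x) = u at *
    generalize nn b θ (M.vec x) = v at *
    generalize (inner ℝ (nnGrad b α (M.vec x)) ω : ℝ) = u' at *
    generalize (inner ℝ (nnGrad b α (M.vec x)) θ : ℝ) = v' at *
    have hconv := even_two.convexOn_pow (𝕜 := ℝ) |>.2 (Set.mem_univ (u - u'))
      (Set.mem_univ (v - v')) hl hl' hadd
    simp only [smul_eq_mul] at hconv
    calc (l * u + l' * v - (l * u' + l' * v')) ^ 2 = (l * (u - u') + l' * (v - v')) ^ 2 := by ring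
      _ ≤ l * (u - u') ^ 2 + l' * (v - v') ^ 2 := hconv
      _ ≤ l * B + l' * B := by gcongr
      _ = B := by rw [← add_mul, hadd, one_mul]

theorem lintegral_sgdOutput_sq_le {T : ℕ} (M : MDP S A d) (p : Params) {k : ℕ} (hk : k < p.K)
    (hT : 64 ≤ T) (μ : Measure (S × A)) [IsProbabilityMeasure μ] {i : Init m d}
    (hb : ∀ j, |i.1 j| = 1) {θ ω : Weights m d} (hθ : ‖θ - i.2‖ ≤ p.Rf) (hω : ‖ω - i.2‖ ≤ p.Rf)
    {B : ℝ} (hB : ∀ α α' : Weights m d, ‖α - i.2‖ ≤ p.Rf → ‖α' - i.2‖ ≤ p.Rf →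
      ∀ x : EuclideanSpace ℝ (Fin d), ‖x‖ ≤ 1 →
        (nn i.1 α' x - inner ℝ (nnGrad i.1 α x) α') ^ 2 ≤ B) :
    ∫⁻ D, ∫⁻ x, ENNReal.ofReal ((nn i.1 (sgdOutput M p k i θ ω D) (M.vec x)
        - target M p k i.1 θ ω x) ^ 2) ∂μ ∂(Measure.pi fun _ : Fin T => μ)
      ≤ ENNReal.ofReal (4 * (p.Rf ^ 2 * (√(T : ℝ))⁻¹) + 10 * B) := by
  have hc : ‖i.2 - i.2‖ ≤ p.Rf := by simpa using (norm_nonneg _).trans hω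
  obtain ⟨z, hz, hzB⟩ := exists_target_approx M hk hθ hω hB
  have hnn : Measurable fun q : Weights m d × (S × A) => nn i.1 q.1 (M.vec q.2) :=
    measurable_nn_comp i.1 measurable_fst (M.measurable_vec.comp measurable_snd)
  have hgrad : Measurable fun q : Weights m d × (S × A) => nnGrad i.1 q.1 (M.vec q.2) :=
    measurable_nnGrad_comp i.1 measurable_fst (M.measurable_vec.comp measurable_snd)
  simp only [sgdOutput]
  exact lintegral_pathAverage_sq_le μ (h := fun α x => nn i.1 α (M.vec x))
    (G := fun α x => nnGrad i.1 α (M.vec x)) (y := target M p k i.1 θ ω) hT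
    (fun α x => norm_nnGrad_le_one hb α (M.norm_vec_le_one x))
    (fun α x => nn_eq_inner_nnGrad _ _ _) hnn hgrad (measurable_target M hk i.1 θ ω) hz hzB
    (fun α x hα => hB i.2 α hc hα _ (M.norm_vec_le_one x))

/-- The choice `t = √(R/√m)` makes the moved neurons contribute `R² · R/√m`. The near-orthogonality
condition scales with `‖x‖`, so a count over unit vectors covers every nonzero `x`. -/
theorem sq_nn_sub_inner_nnGrad_le_of_count {b : Fin m → ℝ} (hb : ∀ i, |b i| = 1)
    (hm : 0 < m) {α₀ α α' : Weights m d} {R n : ℝ} (hR : 0 < R)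
    (hn : ∀ x : EuclideanSpace ℝ (Fin d), ‖x‖ = 1 →
      ((Finset.univ.filter fun i => |inner ℝ (α₀ i) x| ≤ √(R / √(m : ℝ))).card : ℝ) ≤ n)
    (hα : ‖α - α₀‖ ≤ R) (hα' : ‖α' - α₀‖ ≤ R) {x : EuclideanSpace ℝ (Fin d)} (hx : ‖x‖ ≤ 1)
    (hn0 : 0 ≤ n) :
    (nn b α' x - inner ℝ (nnGrad b α x) α') ^ 2
      ≤ 4 * R ^ 2 / m * n + 8 * (R ^ 2 * (R / √(m : ℝ))) := by
  have hm' : (0 : ℝ) < m := by exact_mod_cast hm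
  have hsm : (0 : ℝ) < √(m : ℝ) := by positivity
  by_cases hx0 : x = 0
  · have h0 : ∀ β : Weights m d, nnGrad b β (0 : EuclideanSpace ℝ (Fin d)) = 0 := fun β => by
      ext; simp [nnGrad]
    rw [nn_eq_inner_nnGrad, hx0, h0, h0, inner_zero_left, sub_zero, sq, mul_zero]
    positivity
  · have hxn : 0 < ‖x‖ := norm_pos_iff.2 hx0
    have hr : 0 < R / √(m : ℝ) := by positivity
    refine (sq_nn_sub_inner_nnGrad_le hb (Real.sqrt_pos.2 hr) hα hα' hx).trans ?_
    have hcount := hn (‖x‖⁻¹ • x) (by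
      rw [norm_smul, norm_inv, norm_norm, inv_mul_cancel₀ hxn.ne'])
    have heq : (Finset.univ.filter fun i => |inner ℝ (α₀ i) (‖x‖⁻¹ • x)| ≤ √(R / √(m : ℝ)))
        = Finset.univ.filter fun i => |inner ℝ (α₀ i) x| ≤ √(R / √(m : ℝ)) * ‖x‖ := by
      refine Finset.filter_congr fun i _ => ?_
      rw [real_inner_smul_right, abs_mul, abs_inv, abs_norm, inv_mul_le_iff₀ hxn, mul_comm]
    rw [heq] at hcount
    rw [Real.sq_sqrt hr.le]
    have e1 : R ^ 2 / (R / √(m : ℝ)) = R * √(m : ℝ) := by field_simp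
    have e2 : (m : ℝ)⁻¹ * (R * √(m : ℝ)) = R / √(m : ℝ) := by
      field_simp
      rw [Real.sq_sqrt hm'.le]
    rw [e1]
    calc _ ≤ 4 * R ^ 2 * ((m : ℝ)⁻¹ * (n + 2 * (R * √(m : ℝ)))) := by gcongr
      _ = 4 * R ^ 2 / m * n + 8 * (R ^ 2 * ((m : ℝ)⁻¹ * (R * √(m : ℝ)))) := by ring
      _ = _ := by rw [e2]

/-- This is all that is needed of the TD step: the projection and `RQ ≤ Rf` put `ω_k` in the ball,
whatever its samples are. -/
theorem norm_omega_sub_le {T : ℕ} (hT : 0 < T) (M : MDP S A d) (p : Params)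
    (ξ : Run S A m d T) : ‖Run.omega M p ξ - ξ.1.1.2‖ ≤ p.Rf :=
  (norm_pathAverage_sub_le _ _ p.RQ_pos.le _ hT _).trans p.RQ_le_Rf

theorem norm_thetaBar_sub_le {T : ℕ} (hT : 0 < T) (M : MDP S A d) (p : Params) (k : ℕ)
    (ξ : Run S A m d T) : ‖Run.thetaBar M p k ξ - ξ.1.1.2‖ ≤ p.Rf :=
  norm_pathAverage_sub_le _ _ (p.RQ_pos.le.trans p.RQ_le_Rf) _ hT _

variable [Fintype A]

/-- Only upper bounds are required, and the one-sided forms of change of variables and Tonelli hold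
for arbitrary `Φ`. -/
theorem lintegral_extendLaw_le (M : MDP S A d) (stat : Kernel S A → Measure S) (p : Params)
    (T k : ℕ) (μ : Measure (Init m d × Weights m d)) (Φ : Run S A m d T → ℝ≥0∞) :
    ∫⁻ ξ, Φ ξ ∂(extendLaw M stat p T k μ) ≤ ∫⁻ s, ∫⁻ D, ∫⁻ D', Φ (s, (D, D'))
      ∂(Measure.pi fun _ : Fin T => sigmaTilde M stat p k s.1.1 s.2)
      ∂(Measure.pi fun _ : Fin T => tdLaw M stat p k s.1.1 s.2) ∂μ := by
  unfold extendLaw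
  exact (Measure.lintegral_bind_le _ _ _).trans (lintegral_mono fun s =>
    (lintegral_map_le _ _).trans (lintegral_prod_le _))

section laws

variable [Nonempty A] {M : MDP S A d} {stat : Kernel S A → Measure S}

instance (M : MDP S A d) (p : Params) (k : ℕ) (b : Fin m → ℝ) (θ : Weights m d) :
    IsMarkovKernel (policy M p k b θ) := by
  unfold policy; infer_instance

theorem isProbabilityMeasure_nuK
    (hstat : ∀ π : Kernel S A, IsMarkovKernel π → IsStationary M π (stat π)) (p : Params) (k : ℕ)
    (b : Fin m → ℝ) (θ : Weights m d) : IsProbabilityMeasure (nuK M stat p k b θ) :=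
  (hstat _ inferInstance).1

theorem isProbabilityMeasure_sigmaTilde
    (hstat : ∀ π : Kernel S A, IsMarkovKernel π → IsStationary M π (stat π)) (p : Params) (k : ℕ)
    (b : Fin m → ℝ) (θ : Weights m d) : IsProbabilityMeasure (sigmaTilde M stat p k b θ) := by
  have := isProbabilityMeasure_nuK hstat p k b θ
  unfold sigmaTilde; infer_instance

theorem isProbabilityMeasure_tdLaw
    (hstat : ∀ π : Kernel S A, IsMarkovKernel π → IsStationary M π (stat π)) (p : Params) (k : ℕ)
    (b : Fin m → ℝ) (θ : Weights m d) : IsProbabilityMeasure (tdLaw M stat p k b θ) := by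
  have := isProbabilityMeasure_nuK hstat p k b θ
  have := M.isMarkov
  unfold tdLaw; infer_instance

/-- The initialization keeps its law throughout neural PPO, and the weights stay in the ball of
radius `Rf` around it. -/
theorem lintegral_ppoLaw_le
    (hstat : ∀ π : Kernel S A, IsMarkovKernel π → IsStationary M π (stat π)) (p : Params)
    {T : ℕ} (hT : 0 < T) (W : Init m d → ℝ≥0∞) (k : ℕ) :
    ∫⁻ s, (if ‖s.2 - s.1.2‖ ≤ p.Rf then W s.1 else ∞) ∂(ppoLaw M stat p m T k)
      ≤ ∫⁻ i, W i ∂(initLaw m d) := by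
  have hR : 0 ≤ p.Rf := p.RQ_pos.le.trans p.RQ_le_Rf
  -- The value `∞` outside the ball encodes that `θ_k` almost surely lies in it. Each new average
  -- lies in the ball for every sample, so the samples integrate out and only the initialization is
  -- carried along.
  induction k with
  | zero =>
    rw [ppoLaw]
    exact (lintegral_map_le _ _).trans (lintegral_mono fun i => by simp [hR])
  | succ k ih =>
    rw [ppoLaw]
    refine (lintegral_map_le _ _).trans ?_
    refine (lintegral_extendLaw_le _ _ _ _ _ _ _).trans ?_
    refine (lintegral_mono fun s => ?_).trans ih
    have := isProbabilityMeasure_sigmaTilde hstat p k s.1.1 s.2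
    have := isProbabilityMeasure_tdLaw hstat p k s.1.1 s.2
    have hin : ∀ D D', (if ‖Run.thetaBar M p k (s, ((D, D') :
        (Fin T → ((S × A) × S) × A) × (Fin T → S × A))) - s.1.2‖ ≤ p.Rf then W s.1 else ∞) = W s.1 :=
      fun D D' => if_pos (norm_thetaBar_sub_le hT M p k (s, (D, D')))
    simp only [hin, lintegral_const, measure_univ, mul_one]
    split_ifs
    · exact le_rfl
    · exact le_top

end laws

end

section init

variable {m d : ℕ}

instance : IsProbabilityMeasure signLaw := ⟨by
  simp only [signLaw, Measure.add_apply, Measure.smul_apply, measure_univ, smul_eq_mul, mul_one]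
  exact ENNReal.inv_two_add_inv_two⟩

theorem ae_abs_signLaw : ∀ᵐ y ∂signLaw, |y| = 1 := by
  have hms : MeasurableSet {y : ℝ | |y| = 1} := measurableSet_eq_fun (by fun_prop) measurable_const
  rw [signLaw, ae_add_measure_iff]
  constructor <;> refine Measure.ae_smul_measure ?_ _ <;> rw [ae_dirac_iff hms] <;> simp

/-- The signs are almost surely `±1`, and a bound that does not involve them leaves an integral over
the Gaussian weights alone. -/
theorem lintegral_initLaw_le {W : Init m d → ℝ≥0∞}
    {V : (Fin m → EuclideanSpace ℝ (Fin d)) → ℝ≥0∞}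
    (h : ∀ b α, (∀ i, |b i| = 1) → W (b, WithLp.toLp 2 α) ≤ V α) :
    ∫⁻ i, W i ∂(initLaw m d) ≤ ∫⁻ α, V α ∂(Measure.pi fun _ => initGaussian d) := by
  have hae : ∀ᵐ b ∂(Measure.pi fun _ : Fin m => signLaw), ∀ i, |b i| = 1 :=
    ae_all_iff.2 fun i =>
      (measurePreserving_eval (fun _ : Fin m => signLaw) i).quasiMeasurePreserving.ae
        ae_abs_signLaw
  rw [initLaw]
  refine (lintegral_prod_le _).trans ?_
  calc _ ≤ ∫⁻ _ : Fin m → ℝ, ∫⁻ α, V α ∂(Measure.pi fun _ : Fin m => initGaussian d)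
        ∂(Measure.pi fun _ : Fin m => signLaw) := by
        refine lintegral_mono_ae (hae.mono fun b hb => ?_)
        exact (lintegral_map_le _ _).trans (lintegral_mono fun α => h b α hb)
    _ = _ := by simp

end init

end NeuralPPO

theorem NeuralPPO.rate_identities {R : ℝ} (hR : 0 < R) {m T : ℕ} (hm : 0 < m) :
    R ^ (5 / 2 : ℝ) * (m : ℝ) ^ (-(1 / 4) : ℝ) = R ^ 2 * √(R / √(m : ℝ)) ∧
      R ^ 3 * (m : ℝ) ^ (-(1 / 2) : ℝ) = R ^ 2 * (R / √(m : ℝ)) ∧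
      (T : ℝ) ^ (-(1 / 2) : ℝ) = (√(T : ℝ))⁻¹ := by
  have hm' : (0 : ℝ) < m := by exact_mod_cast hm
  refine ⟨?_, ?_, ?_⟩
  · have h1 : R ^ (5 / 2 : ℝ) = R ^ 2 * √R := by
      rw [Real.sqrt_eq_rpow, ← Real.rpow_natCast R 2, ← Real.rpow_add hR]
      norm_num
    have h2 : (m : ℝ) ^ (1 / 4 : ℝ) = √(√(m : ℝ)) := by
      rw [Real.sqrt_eq_rpow, Real.sqrt_eq_rpow, ← Real.rpow_mul hm'.le]
      norm_num
    rw [Real.sqrt_div hR.le, h1, Real.rpow_neg hm'.le, h2]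
    ring
  · rw [Real.rpow_neg hm'.le, ← Real.sqrt_eq_rpow]
    ring
  · rw [Real.rpow_neg (Nat.cast_nonneg _), ← Real.sqrt_eq_rpow]

theorem mainTheorem4 (d : ℕ) (c r₀ : ℝ) (hc : 0 < c) (hr₀ : 0 < r₀) :
    ∃ C : ℝ, 0 < C ∧
      ∀ (S A : Type*) [MeasurableSpace S] [MeasurableSpace A] [MeasurableSingletonClass A]
        [Fintype A] [Nonempty A]
        (M : NeuralPPO.MDP S A d) (stat : Kernel S A → Measure S) (p : NeuralPPO.Params)
        (m T k : ℕ),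
        (∀ π : Kernel S A, IsMarkovKernel π → NeuralPPO.IsStationary M π (stat π)) →
        NeuralPPO.BoundedReward M →
        NeuralPPO.RegularStationary M stat c →
        r₀ ≤ p.Rf → 1 ≤ m → 64 ≤ T → k < p.K →
        (∀ j < p.K, Measurable fun i : NeuralPPO.Init m d => NeuralPPO.nuK M stat p j i.1 i.2) →
        ∫⁻ ξ, ∫⁻ x, ENNReal.ofReal
            ((NeuralPPO.nn ξ.1.1.1 (NeuralPPO.Run.thetaBar M p k ξ) (M.vec x)
              - NeuralPPO.target M p k ξ.1.1.1 ξ.1.2 (NeuralPPO.Run.omega M p ξ) x) ^ 2)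
            ∂(NeuralPPO.sigmaTilde M stat p k ξ.1.1.1 ξ.1.2)
          ∂(NeuralPPO.runLaw M stat p m T k)
        ≤ ENNReal.ofReal (C * (p.Rf ^ 2 * (T : ℝ) ^ (-(1 / 2) : ℝ)
            + p.Rf ^ (5 / 2 : ℝ) * (m : ℝ) ^ (-(1 / 4) : ℝ)
            + p.Rf ^ 3 * (m : ℝ) ^ (-(1 / 2) : ℝ))) := by
  -- In dimension zero every network vanishes.
  rcases Nat.eq_zero_or_pos d with rfl | hd
  · refine ⟨1, one_pos, ?_⟩
    intro S A _ _ _ _ _ M stat p m T k _ _ _ _ _ _ hk _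
    have hnn : ∀ (b : Fin m → ℝ) α (x : EuclideanSpace ℝ (Fin 0)), NeuralPPO.nn b α x = 0 :=
      fun b α x => by simp [NeuralPPO.nn, Subsingleton.elim x 0]
    simp [NeuralPPO.target_eq M hk, hnn]
  obtain ⟨C, hC, hcount⟩ := NeuralPPO.exists_uniform_count_le hd hr₀
  refine ⟨84 + 40 * C, by positivity, ?_⟩
  intro S A _ _ _ _ _ M stat p m T k hstat _ _ hR hm hT hk _
  obtain ⟨W, hWm, hW, hWint⟩ := hcount m p.Rf hm hR
  have hR0 : 0 < p.Rf := hr₀.trans_le hR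
  have hm' : (0 : ℝ) < m := by exact_mod_cast hm
  set r : ℝ := p.Rf / √(m : ℝ) with hr
  have hr0 : 0 < r := by positivity
  let a : ℝ := 4 * (p.Rf ^ 2 * (√(T : ℝ))⁻¹) + 80 * (p.Rf ^ 2 * r)
  have ha : 0 ≤ a := by positivity
  let V : (Fin m → EuclideanSpace ℝ (Fin d)) → ℝ≥0∞ := fun α =>
    ENNReal.ofReal a + ENNReal.ofReal (40 * p.Rf ^ 2 / m) * W α
  classical
  -- The value `∞` discards the null set of sign vectors other than `±1`.
  let V' : NeuralPPO.Init m d → ℝ≥0∞ := fun i =>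
    if ∀ j, |i.1 j| = 1 then V (WithLp.ofLp i.2) else ∞
  calc _ ≤ ∫⁻ s, (if ‖s.2 - s.1.2‖ ≤ p.Rf then V' s.1 else ∞)
        ∂(NeuralPPO.ppoLaw M stat p m T k) := by
        refine (NeuralPPO.lintegral_extendLaw_le _ _ _ _ _ _ _).trans (lintegral_mono fun s => ?_)
        split_ifs with hs
        swap
        · exact le_top
        by_cases hb : ∀ j, |s.1.1 j| = 1
        swap
        · simp [V', hb]
        simp only [V', if_pos hb]
        by_cases hWtop : W (WithLp.ofLp s.1.2) = ∞
        · have h0 : ENNReal.ofReal (40 * p.Rf ^ 2 / m) ≠ 0 := by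
            rw [Ne, ENNReal.ofReal_eq_zero, not_le]; positivity
          simp [V, hWtop, ENNReal.mul_top h0]
        have := NeuralPPO.isProbabilityMeasure_sigmaTilde hstat p k s.1.1 s.2
        have := NeuralPPO.isProbabilityMeasure_tdLaw hstat p k s.1.1 s.2
        have hn : ∀ x : EuclideanSpace ℝ (Fin d), ‖x‖ = 1 →
            ((Finset.univ.filter fun i => |inner ℝ (s.1.2 i) x| ≤ √r).card : ℝ)
              ≤ (W (WithLp.ofLp s.1.2)).toReal := fun x hx => by
          rw [← ENNReal.toReal_natCast]
          exact ENNReal.toReal_mono hWtop (hW (WithLp.ofLp s.1.2) x hx)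
        calc _ ≤ ∫⁻ _, V (WithLp.ofLp s.1.2)
              ∂(Measure.pi fun _ : Fin T => NeuralPPO.tdLaw M stat p k s.1.1 s.2) := by
              refine lintegral_mono fun D => ?_
              refine (NeuralPPO.lintegral_sgdOutput_sq_le M p hk hT
                (NeuralPPO.sigmaTilde M stat p k s.1.1 s.2) hb hs
                (NeuralPPO.norm_omega_sub_le (T := T) (by omega) M p
                  -- `Run.omega` ignores the SGD samples, so any point of `S × A` fills that slot;
                  -- one is taken from the TD data.
                  (s, (D, fun _ => (D ⟨0, by omega⟩).1.1)))
                fun α α' hα hα' x hx => NeuralPPO.sq_nn_sub_inner_nnGrad_le_of_count hb hm hR0 hn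
                  hα hα' hx ENNReal.toReal_nonneg).trans_eq ?_
              simp only [V]
              conv_rhs => rw [← ENNReal.ofReal_toReal hWtop]
              rw [← ENNReal.ofReal_mul (by positivity), ← ENNReal.ofReal_add ha (by positivity)]
              congr 1
              simp only [a]
              ring
          _ = V (WithLp.ofLp s.1.2) := by simp
    _ ≤ ∫⁻ i, V' i ∂(NeuralPPO.initLaw m d) :=
        NeuralPPO.lintegral_ppoLaw_le hstat p (by omega) V' k
    _ ≤ ∫⁻ α, V α ∂(Measure.pi fun _ => NeuralPPO.initGaussian d) :=
        NeuralPPO.lintegral_initLaw_le fun b α hb => by simp [V', hb]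
    _ = ENNReal.ofReal a + ENNReal.ofReal (40 * p.Rf ^ 2 / m)
          * ∫⁻ α, W α ∂(Measure.pi fun _ => NeuralPPO.initGaussian d) := by
        rw [lintegral_add_left measurable_const, lintegral_const_mul _ hWm]
        simp
    _ ≤ ENNReal.ofReal a + ENNReal.ofReal (40 * p.Rf ^ 2 / m)
          * ENNReal.ofReal (C * (m * (√r + r))) := by gcongr
    _ = ENNReal.ofReal (a + 40 * p.Rf ^ 2 / m * (C * (m * (√r + r)))) := by
        rw [← ENNReal.ofReal_mul (by positivity), ← ENNReal.ofReal_add ha (by positivity)]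
    _ ≤ _ := by
        refine ENNReal.ofReal_le_ofReal ?_
        obtain ⟨e1, e2, e3⟩ := NeuralPPO.rate_identities (T := T) hR0 (m := m) hm
        rw [e1, e2, e3, ← hr]
        -- The factor 40 is `10 · 4`; together with `a`, whose coefficients are 4 and `10 · 8`,
        -- everything is covered by `84 + 40 C`.
        have e4 : 40 * p.Rf ^ 2 / m * (C * (m * (√r + r)))
            = 40 * C * (p.Rf ^ 2 * √r) + 40 * C * (p.Rf ^ 2 * r) := by field_simp
        rw [e4]
        simp only [a]
        have h1 : 0 ≤ p.Rf ^ 2 * (√(T : ℝ))⁻¹ := by positivity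
        have h2 : 0 ≤ p.Rf ^ 2 * √r := by positivity
        have h3 : 0 ≤ p.Rf ^ 2 * r := by positivity
        nlinarith [mul_nonneg hC.le h1]
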